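/- Let $N$ be a free abelian group of rank $r$, let $M=\mathrm{Hom}(N,\mathbb Z)$, and let $K\subset N\otimes\mathbb R$ be a rational polyhedral cone (spanned by finitely many lattice vectors) with $K-K=N\otimes\mathbb R$ and $K\cap(-K)=\{0\}$. Assume that $K$ is graded: there is an element $\deg\in M$ that takes the value $1$ on the integer generators of all one-dimensional faces of $K$. Let $R=\mathbb C[K]$ be the semigroup ring of $K\cap N$, with monomials $x^n$, and let $R^{open}=\mathbb C[K^{open}]\subset R$ be the ideal spanned over $\mathbb C$ by the $x^n$ with $n$ a lattice point of the interior $K^{open}$ of $K$. (1) Let $e_1,\dots,e_d$ be distinct lattice points of degree $1$ in $K$ that include the integer generators of all one-dimensional faces of $K$, put $x_i=x^{e_i}$, and let $m_1,\dots,m_r$ be a basis of $M\otimes\mathbb C$. For $a=(a_1,\dots,a_d)\in\mathbb C^d$ let $$Z_j=\sum_{i=1}^d\langle m_j,e_i\rangle\,e^{2\pi\mathrm{i}a_i}\,x_i\in R,\qquad j=1,\dots,r.$$ Then for generic $a$ the sequence $Z_1,\dots,Z_r$ is regular on $R$ and on the $R$-module $R^{open}$. Here ``generic'' means: there is a nonzero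 polynomial $P\in\mathbb C[t_1,\dots,t_d]$ such that the assertion holds for all $a\in\mathbb C^d$ with $P(e^{2\pi\mathrm{i}a_1},\dots,e^{2\pi\mathrm{i}a_d})\neq 0$. A sequence is regular on a module $Q$ if each $Z_j$ is a non-zero-divisor on $Q/(Z_1,\dots,Z_{j-1})Q$ and $Q\ne(Z_1,\dots,Z_r)Q$. (2) $R$ is a Cohen--Macaulay ring (Hochster's theorem for graded cones), and $R^{open}$ is a Cohen--Macaulay $R$-module. Here a module $Q$ over a commutative ring $A$ is Cohen--Macaulay if $A$ is Noetherian, $Q$ is finitely generated and $\operatorname{depth}Q_{\mathfrak m}=\dim Q_{\mathfrak m}$ for every maximal ideal $\mathfrak m$ of $A$ with $Q_{\mathfrak m}\neq0$; a ring is Cohen--Macaulay if it is so as a module over itself. -/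

import Mathlib

open scoped TensorProduct

noncomputable section

namespace GradedCone

variable {N : Type*} [AddCommGroup N]

/-- The canonical map from the lattice `N` to the real vector space `N ⊗ ℝ`. -/
def toReal : N →+ ℝ ⊗[ℤ] N :=
  ((TensorProduct.mk ℤ ℝ N) 1).toAddMonoidHom

/-- A rational polyhedral cone: a cone spanned by finitely many lattice vectors. -/
def IsRationalPolyhedral (K : PointedCone ℝ (ℝ ⊗[ℤ] N)) : Prop :=
  ∃ s : Finset N, K = PointedCone.hull ℝ (toReal '' (s : Set N))

/-- `n` is the integer generator of a one-dimensional face of `K`: the ray `ℝ≥0 n` is a face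
of `K` and every lattice point of this ray is a natural multiple of `n`. -/
structure IsRayGenerator (K : PointedCone ℝ (ℝ ⊗[ℤ] N)) (n : N) : Prop where
  ne_zero : n ≠ 0
  isFaceOf : (PointedCone.hull ℝ {toReal n}).IsFaceOf K
  generates : ∀ x : N, toReal x ∈ PointedCone.hull ℝ {toReal n} → ∃ k : ℕ, x = k • n

/-- `K` is a rational polyhedral cone in `N ⊗ ℝ` with `K - K = N ⊗ ℝ` and `K ∩ (-K) = {0}`, and
the linear form `deg` takes the value `1` on the integer generators of all one-dimensional faces
of `K`. -/
structure IsGradedCone (K : PointedCone ℝ (ℝ ⊗[ℤ] N)) (deg : Module.Dual ℤ N) : Prop where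
  rationalPolyhedral : IsRationalPolyhedral K
  full : ∀ v : ℝ ⊗[ℤ] N, ∃ x ∈ K, ∃ y ∈ K, v = x - y
  pointed : ∀ x ∈ K, -x ∈ K → x = 0
  deg_rayGenerator : ∀ n : N, IsRayGenerator K n → deg n = 1

/-- The semigroup `K ∩ N` of lattice points of `K`. -/
def latticePoints (K : PointedCone ℝ (ℝ ⊗[ℤ] N)) : AddSubmonoid N :=
  K.toAddSubmonoid.comap toReal

/-- The interior of `K`, for the canonical (module) topology of the real vector space `N ⊗ ℝ`,
which is the Euclidean topology when `N` has finite rank. -/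
def openCone (K : PointedCone ℝ (ℝ ⊗[ℤ] N)) : Set (ℝ ⊗[ℤ] N) :=
  @interior _ (moduleTopology ℝ (ℝ ⊗[ℤ] N)) (K : Set (ℝ ⊗[ℤ] N))

theorem add_mem_openCone {K : PointedCone ℝ (ℝ ⊗[ℤ] N)} {x y : ℝ ⊗[ℤ] N}
    (hx : x ∈ K) (hy : y ∈ openCone K) : x + y ∈ openCone K := by
  let _ : TopologicalSpace (ℝ ⊗[ℤ] N) := moduleTopology ℝ (ℝ ⊗[ℤ] N)
  have : ContinuousAdd (ℝ ⊗[ℤ] N) := ModuleTopology.continuousAdd ℝ (ℝ ⊗[ℤ] N)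
  change y ∈ interior (K : Set (ℝ ⊗[ℤ] N)) at hy
  change x + y ∈ interior (K : Set (ℝ ⊗[ℤ] N))
  have h : (Homeomorph.addLeft x) '' interior (K : Set (ℝ ⊗[ℤ] N)) ⊆
      interior (K : Set (ℝ ⊗[ℤ] N)) := by
    refine interior_maximal ?_ ((Homeomorph.addLeft x).isOpenMap _ isOpen_interior)
    rintro _ ⟨z, hz, rfl⟩
    exact K.add_mem hx (interior_subset hz)
  exact h ⟨y, hy, rfl⟩

/-- The semigroup ring `R = ℂ[K]`. -/
abbrev semigroupRing (K : PointedCone ℝ (ℝ ⊗[ℤ] N)) : Type _ :=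
  AddMonoidAlgebra ℂ (latticePoints K)

/-- `R^open = ℂ[K^open]`, the ideal of `R` of all combinations of the `x^n` with `n` a lattice
point of the interior of `K`. -/
def openIdeal (K : PointedCone ℝ (ℝ ⊗[ℤ] N)) : Ideal (semigroupRing K) where
  carrier := {f | ∀ n ∈ f.coeff.support, toReal (n : N) ∈ openCone K}
  zero_mem' := by simp
  add_mem' := by
    classical
    intro f g hf hg n hn
    rcases Finset.mem_union.1 (Finsupp.support_add hn) with h | h
    · exact hf n h
    · exact hg n h
  smul_mem' := by
    classical
    intro f g hg n hn
    obtain ⟨a, -, b, hb, rfl⟩ := Finset.mem_add.1 (AddMonoidAlgebra.support_coeff_mul_subset f g hn)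
    rw [AddSubmonoid.coe_add, map_add]
    exact add_mem_openCone a.2 (hg b hb)

/-- The pairing `⟨m, n⟩` of `m ∈ M ⊗ ℂ`, where `M = Hom(N, ℤ)`, with `n ∈ N`. -/
def pairing (m : ℂ ⊗[ℤ] Module.Dual ℤ N) (n : N) : ℂ :=
  TensorProduct.rid ℤ ℂ ((Module.Dual.eval ℤ N n).lTensor ℂ m)

theorem pairing_tmul (z : ℂ) (f : Module.Dual ℤ N) (n : N) :
    pairing (z ⊗ₜ[ℤ] f) n = z * (f n : ℂ) := by
  simp [pairing, mul_comm]

/-- The element `Z = ∑ i, ⟨m, e i⟩ exp (2 π i a i) x_i` of `ℂ[K]`, where `x_i` is the monomial of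
the lattice point `e i` of `K`. -/
def linearElement (K : PointedCone ℝ (ℝ ⊗[ℤ] N)) {d : ℕ} (e : Fin d → latticePoints K)
    (a : Fin d → ℂ) (m : ℂ ⊗[ℤ] Module.Dual ℤ N) : semigroupRing K :=
  ∑ i, AddMonoidAlgebra.single (e i)
    (pairing m (e i : N) * Complex.exp (2 * Real.pi * Complex.I * a i))

/-- A property of `a = (a_1, …, a_d)` holds for generic `a` if it holds whenever the point
`(exp (2 π i a_1), …, exp (2 π i a_d))` of the torus lies outside a proper Zariski closed set. -/
def ForGeneric {d : ℕ} (p : (Fin d → ℂ) → Prop) : Prop :=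
  ∃ P : MvPolynomial (Fin d) ℂ, P ≠ 0 ∧ ∀ a : Fin d → ℂ,
    MvPolynomial.eval (fun i => Complex.exp (2 * Real.pi * Complex.I * a i)) P ≠ 0 → p a

/-- The depth of a module over a local ring: the supremum of the lengths of the `M`-regular
sequences in the maximal ideal. -/
def depth (A M : Type*) [CommRing A] [IsLocalRing A] [AddCommGroup M] [Module A M] : ℕ∞ :=
  ⨆ (rs : List A) (_ : RingTheory.Sequence.IsRegular M rs ∧
    ∀ x ∈ rs, x ∈ IsLocalRing.maximalIdeal A), (rs.length : ℕ∞)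

/-- Cohen-Macaulay modules: finitely generated modules `M` over a Noetherian ring `A` such that
`depth M_𝔪 = dim M_𝔪` for all maximal ideals `𝔪` in the support of `M`. -/
structure IsCohenMacaulayModule (A M : Type*) [CommRing A] [AddCommGroup M] [Module A M] :
    Prop where
  noetherian : IsNoetherianRing A
  finite : Module.Finite A M
  depth_eq_dim : ∀ (𝔪 : Ideal A) [𝔪.IsMaximal],
    Nontrivial (LocalizedModule 𝔪.primeCompl M) →
      ((depth (Localization.AtPrime 𝔪) (LocalizedModule 𝔪.primeCompl M) : ℕ∞) : WithBot ℕ∞) =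
        Module.supportDim (Localization.AtPrime 𝔪) (LocalizedModule 𝔪.primeCompl M)

/-- Cohen-Macaulay rings: rings that are Cohen-Macaulay as modules over themselves. -/
def IsCohenMacaulayRing (A : Type*) [CommRing A] : Prop :=
  IsCohenMacaulayModule A A

end GradedCone

end

/-!
The elements `Z₁, …, Z_r` define a map from the polynomial ring `ℂ[t₁, …, t_r]` to `R`. For generic
coefficients both `R` and `R^open` are shown to be free of finite positive rank over the polynomial
ring through this map (`exists_polynomial_free`). The variables are a regular sequence on every
nonzero free module, which is the first assertion. For the second one, every maximal ideal `𝔪` of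
`R` contains, by the Nullstellensatz, a translate `Z_j - a_j` of the sequence, which is regular
too; so the depth at `𝔪` is at least `r`, and it is at most the dimension of `R`, which is at most
`r` as `R` is finite over the polynomial ring (`isCohenMacaulayModule_of_free`).

The two modules are treated at once. If `u` is a small generic vector in the interior of `K`, then
a lattice point `n` lies in `K` if and only if `n + u` does, and it lies in the interior of `K` if
and only if `n - u` lies in `K` (`exists_shiftedCones`). So both modules are spanned by the monomials
`x ^ n` for which the shift of `n` lies in `K`, and no shifted lattice point lies on a wall of a
simplicial cone over some of the `e l`. This situation is the structure `ShiftedCone`.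

Generic heights `h l` of the points `e l` define a regular triangulation of `K`. Its cones are the
frames `σ` whose linear form, which takes the values `h` on `σ`, lies above `h` elsewhere
(`Frame.Dominates`). They cover `K` by a linear programming argument (`Frame.exists_dominates`), and
their linear forms fit together to a superadditive weight on lattice points, which is additive
only within a cone. A lattice point `n` in the cone of `σ` is uniquely a point of a half-open
fundamental box plus a nonnegative integral combination of the vectors of `σ`. Replacing in this
decomposition each vector of `σ` by the linear element of its dual coordinate function gives
an element `E_n` of the module, homogeneous of the degree of `n` (`ShiftedCone.element`). For the
coefficients `T ^ h l` the rescaled matrix of coefficients of the `E_n` tends to the identity as `T`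
tends to infinity (`ShiftedCone.tendsto_coeff_element`). Hence in each finite range of degrees its
determinant is a nonzero polynomial in the coefficients of the linear elements.

The box monomials are the candidate basis over the polynomial ring: the `E_n` are exactly their
products with monomials in a linear coordinate system of the polynomial ring that depends on the
cell. If the determinant does not vanish in the range of degrees that contains the box monomials and
their products with the `e l`, then the box monomials generate a submodule stable under all
`x ^ (e l)`, so they generate the module. In each degree there are as many `E_n` as monomials, so the
`E_n` are then linearly independent, which is freeness
(`ShiftedCone.exists_polynomial_presentation`).
-/

noncomputable section

open scoped Topology

namespace GradedCone

/-! ### Frames and regular triangulations -/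

section Frames

variable {d : ℕ} {E : Type*} [AddCommGroup E] [Module ℝ E]

/-- A frame of a finite family of vectors `e` is a set of indices for which the vectors form a
basis of the ambient space. Frames index the full-dimensional simplicial cones spanned by members
of the family. -/
def Frame (e : Fin d → E) : Type :=
  {σ : Finset (Fin d) // LinearIndepOn ℝ e (σ : Set (Fin d)) ∧
    ⊤ ≤ Submodule.span ℝ (e '' (σ : Set (Fin d)))}

instance (e : Fin d → E) : Finite (Frame e) := Subtype.finite

namespace Frame

variable {e : Fin d → E}

instance : Membership (Fin d) (Frame e) := ⟨fun σ l => l ∈ σ.1⟩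

theorem exists_coord (σ : Frame e) : ∃ L : E →ₗ[ℝ] (Fin d → ℝ),
    (∀ v, ∑ l, L v l • e l = v) ∧ (∀ v, ∀ l ∉ σ, L v l = 0) ∧
      ∀ l ∈ σ, L (e l) = Pi.single l 1 := by
  classical
  have hli : LinearIndependent ℝ (fun i : (σ.1 : Set (Fin d)) => e i) := σ.2.1
  have hsp : ⊤ ≤ Submodule.span ℝ (Set.range fun i : (σ.1 : Set (Fin d)) => e i) := by
    rw [← Set.image_eq_range]; exact σ.2.2
  let b := Module.Basis.mk hli hsp
  have hb : ∀ i, b i = e i := fun i => by simp [b]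
  let L : E →ₗ[ℝ] (Fin d → ℝ) := b.constr ℝ fun i => Pi.single (i : Fin d) (1 : ℝ)
  have hL : ∀ i : (σ.1 : Set (Fin d)), L (e i) = Pi.single (i : Fin d) (1 : ℝ) := fun i => by
    rw [← hb, b.constr_basis]
  refine ⟨L, fun v => ?_, fun v l hl => ?_, fun l hl => hL ⟨l, hl⟩⟩
  · have : (∑ l, (LinearMap.proj l ∘ₗ L).smulRight (e l)) = LinearMap.id := by
      refine b.ext fun i => ?_
      rw [hb, LinearMap.sum_apply]
      simp only [LinearMap.smulRight_apply, LinearMap.comp_apply, hL, LinearMap.proj_apply,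
        LinearMap.id_apply]
      rw [Finset.sum_eq_single (i : Fin d)] <;> simp +contextual
    simpa [LinearMap.sum_apply] using LinearMap.congr_fun this v
  · have : LinearMap.proj l ∘ₗ L = 0 := by
      refine b.ext fun i => ?_
      have hne : l ≠ i := fun h => hl (h ▸ i.2)
      rw [hb, LinearMap.comp_apply, hL]
      simp [hne]
    simpa using LinearMap.congr_fun this v

/-- The coordinates of a vector in the basis given by a frame, extended by zero to all indices. -/
def coord (σ : Frame e) : E →ₗ[ℝ] (Fin d → ℝ) := σ.exists_coord.choose

theorem sum_coord (σ : Frame e) (v : E) : ∑ l, σ.coord v l • e l = v :=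
  σ.exists_coord.choose_spec.1 v

theorem coord_of_notMem (σ : Frame e) (v : E) {l : Fin d} (hl : l ∉ σ) : σ.coord v l = 0 :=
  σ.exists_coord.choose_spec.2.1 v l hl

theorem coord_self (σ : Frame e) {l : Fin d} (hl : l ∈ σ) : σ.coord (e l) = Pi.single l 1 :=
  σ.exists_coord.choose_spec.2.2 l hl

theorem coord_sum (σ : Frame e) {a : Fin d → ℝ} (ha : ∀ l ∉ σ, a l = 0) :
    σ.coord (∑ l, a l • e l) = a := by
  classical
  rw [map_sum]
  conv_rhs => rw [← Finset.univ_sum_single a]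
  refine Finset.sum_congr rfl fun l _ => ?_
  by_cases hl : l ∈ σ
  · rw [map_smul, σ.coord_self hl]
    ext k
    simp [Pi.single_apply]
  · simp [ha l hl]

theorem eq_of_subset {σ τ : Frame e} (h : ∀ l ∈ σ, l ∈ τ) : σ = τ := by
  refine Subtype.ext (Finset.Subset.antisymm h fun l hl => ?_)
  by_contra hlσ
  have h1 := τ.coord_sum (a := σ.coord (e l)) fun k hk =>
    σ.coord_of_notMem _ fun hk' => hk (h k hk')
  rw [σ.sum_coord, τ.coord_self hl] at h1
  have h2 := congrFun h1 l
  rw [σ.coord_of_notMem _ hlσ] at h2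
  simp at h2

/-- The linear form on the ambient space with prescribed values `h` on the vectors of a frame. -/
def height (σ : Frame e) (h : Fin d → ℝ) : E →ₗ[ℝ] ℝ :=
  (∑ l, h l • LinearMap.proj l) ∘ₗ σ.coord

theorem height_apply (σ : Frame e) (h : Fin d → ℝ) (v : E) :
    σ.height h v = ∑ l, h l * σ.coord v l := by
  simp [height]

theorem height_self (σ : Frame e) (h : Fin d → ℝ) {l : Fin d} (hl : l ∈ σ) :
    σ.height h (e l) = h l := by
  rw [height_apply, σ.coord_self hl]
  simp [Pi.single_apply]

/-- A frame dominates the heights `h` if its linear form lies strictly above `h` at every vector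
outside the frame. For generic `h` the cones over the dominating frames are the maximal cones of
the regular triangulation defined by `h`. -/
def Dominates (σ : Frame e) (h : Fin d → ℝ) : Prop := ∀ l ∉ σ, h l < σ.height h (e l)

theorem Dominates.le {σ : Frame e} {h : Fin d → ℝ} (hσ : σ.Dominates h) (l : Fin d) :
    h l ≤ σ.height h (e l) := by
  by_cases hl : l ∈ σ
  · exact (σ.height_self h hl).ge
  · exact (hσ l hl).le

/-- The linear form of a dominating frame is strictly larger than the one of any other frame in
the interior of the cone over that other frame. -/
theorem Dominates.height_lt {σ τ : Frame e} {h : Fin d → ℝ} (hτ : τ.Dominates h) (hne : σ ≠ τ)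
    {v : E} (hv : ∀ l ∈ σ, 0 < σ.coord v l) : σ.height h v < τ.height h v := by
  obtain ⟨k, hk, hk'⟩ : ∃ k ∈ σ, k ∉ τ := by
    by_contra! H
    exact hne (eq_of_subset H)
  conv_rhs => rw [← σ.sum_coord v, map_sum]
  rw [height_apply]
  refine Finset.sum_lt_sum (fun l _ => ?_) ⟨k, Finset.mem_univ _, ?_⟩
  · rw [map_smul, smul_eq_mul, mul_comm]
    by_cases hl : l ∈ σ
    · exact mul_le_mul_of_nonneg_left (hτ.le l) (hv l hl).le
    · simp [σ.coord_of_notMem v hl]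
  · rw [map_smul, smul_eq_mul, mul_comm]
    exact mul_lt_mul_of_pos_left (hτ k hk') (hv k hk)

/-- Carathéodory's theorem for cones over a family in an affine hyperplane, with control of a
linear objective: a nonnegative combination can be supported on a frame without decreasing the
objective. -/
theorem exists_frame_le_height (φ : E →ₗ[ℝ] ℝ) (hφ : ∀ l, φ (e l) = 1)
    (hspan : Submodule.span ℝ (Set.range e) = ⊤) (h : Fin d → ℝ) (v : E) (a : Fin d → ℝ)
    (ha : ∀ l, 0 ≤ a l) (hv : ∑ l, a l • e l = v) :
    ∃ σ : Frame e, (∀ l, 0 ≤ σ.coord v l) ∧ ∑ l, h l * a l ≤ σ.height h v := by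
  classical
  induction hn : (Finset.univ.filter fun l => a l ≠ 0).card using Nat.strong_induction_on
    generalizing a with
  | _ n ih =>
  set s := Finset.univ.filter fun l => a l ≠ 0 with hs
  have hmem : ∀ l, l ∈ s ↔ a l ≠ 0 := fun l => by simp [hs]
  by_cases hli : LinearIndepOn ℝ e (s : Set (Fin d))
  · have hext := hli.linearIndepOn_extend (Set.subset_univ _)
    have hsub := hli.subset_extend (Set.subset_univ _)
    have hsp := hli.image_subset_span_image_extend (Set.subset_univ _)
    let σ : Frame e := ⟨(hli.extend (Set.subset_univ _)).toFinset, by simpa using hext, by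
      rw [← hspan, Submodule.span_le]
      simpa using hsp⟩
    have hc : σ.coord v = a := by
      rw [← hv]
      refine σ.coord_sum fun l hl => ?_
      by_contra h0
      exact hl (Set.mem_toFinset.2 (hsub ((hmem l).2 h0)))
    refine ⟨σ, fun l => hc ▸ ha l, ?_⟩
    rw [height_apply, hc]
  · rw [linearIndepOn_finset_iff] at hli
    push Not at hli
    -- a linear relation on the support, with the sign chosen so that it raises the objective
    obtain ⟨β, hβ0, hβs, hβne, hβh⟩ : ∃ β : Fin d → ℝ, ∑ l, β l • e l = 0 ∧
        (∀ l ∉ s, β l = 0) ∧ (∃ l, β l ≠ 0) ∧ 0 ≤ ∑ l, h l * β l := by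
      obtain ⟨f, hf0, i, his, hfi⟩ := hli
      have key : ∀ ε : ℝ, ε ≠ 0 → ∃ β : Fin d → ℝ, ∑ l, β l • e l = 0 ∧
          (∀ l ∉ s, β l = 0) ∧ (∃ l, β l ≠ 0) ∧
          ∑ l, h l * β l = ε * ∑ l ∈ s, h l * f l := by
        intro ε hε
        refine ⟨fun l => if l ∈ s then ε * f l else 0, ?_, ?_, ⟨i, ?_⟩, ?_⟩
        · simp only [ite_smul, zero_smul, Finset.sum_ite_mem, Finset.univ_inter, mul_smul]
          rw [← Finset.smul_sum, hf0, smul_zero]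
        · intro l hl
          simp [hl]
        · simp [his, hε, hfi]
        · simp only [mul_ite, mul_zero, Finset.sum_ite_mem, Finset.univ_inter, Finset.mul_sum]
          exact Finset.sum_congr rfl fun l _ => by ring
      rcases le_total 0 (∑ l ∈ s, h l * f l) with h0 | h0
      · obtain ⟨β, h1, h2, h3, h4⟩ := key 1 one_ne_zero
        exact ⟨β, h1, h2, h3, by rw [h4]; linarith⟩
      · obtain ⟨β, h1, h2, h3, h4⟩ := key (-1) (by norm_num)
        exact ⟨β, h1, h2, h3, by rw [h4]; linarith⟩
    have hsum : ∑ l, β l = 0 := by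
      have := congrArg φ hβ0
      simpa [map_sum, hφ] using this
    obtain ⟨l₁, hl₁⟩ : ∃ l, β l < 0 := by
      by_contra! H
      obtain ⟨l, hl⟩ := hβne
      exact hl ((Finset.sum_eq_zero_iff_of_nonneg fun l _ => H l).1 hsum l (Finset.mem_univ l))
    obtain ⟨l₀, hl₀, hmin⟩ := (Finset.univ.filter fun l => β l < 0).exists_min_image
      (fun l => a l / -β l) ⟨l₁, by simp [hl₁]⟩
    have hl₀' : β l₀ < 0 := by simpa using hl₀
    -- the largest step along the relation that keeps all coefficients nonnegative; it removes `l₀`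
    set t := a l₀ / -β l₀ with ht
    have ht0 : 0 ≤ t := div_nonneg (ha _) (by linarith)
    have hl₀s : a l₀ ≠ 0 := fun h0 => hl₀'.ne (hβs l₀ (by simp [hmem, h0]))
    have ha' : ∀ l, 0 ≤ a l + t * β l := fun l => by
      rcases le_or_gt 0 (β l) with h0 | h0
      · have := ha l
        positivity
      · have := hmin l (by simp [h0])
        rw [le_div_iff₀ (by linarith)] at this
        linarith
    have hzero : a l₀ + t * β l₀ = 0 := by
      rw [ht, div_neg, neg_mul, div_mul_cancel₀ _ hl₀'.ne, add_neg_cancel]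
    obtain ⟨σ, h1, h2⟩ := ih (Finset.univ.filter fun l => a l + t * β l ≠ 0).card (by
      rw [← hn]
      refine Finset.card_lt_card ⟨fun l hl => ?_, fun H => ?_⟩
      · rw [hmem]
        intro h0
        have : β l = 0 := hβs l (by simp [hmem, h0])
        simp [h0, this] at hl
      · have := H ((hmem l₀).2 hl₀s)
        simp [hzero] at this) (fun l => a l + t * β l) ha' (by
      simp only [add_smul, mul_smul, Finset.sum_add_distrib]
      rw [← Finset.smul_sum, hβ0, hv]
      simp) rfl
    refine ⟨σ, h1, le_trans ?_ h2⟩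
    have : ∑ l, h l * (a l + t * β l) = ∑ l, h l * a l + t * ∑ l, h l * β l := by
      rw [Finset.mul_sum, ← Finset.sum_add_distrib]
      exact Finset.sum_congr rfl fun l _ => by ring
    rw [this]
    have := mul_nonneg ht0 hβh
    linarith

/-- The dominating frames cover: among the frames whose cone contains a generic vector `v` of the
cone over `e`, one with the largest value of the linear form at `v` dominates `h`, because a
vector violating this could enter the combination and raise the value. -/
theorem exists_dominates (φ : E →ₗ[ℝ] ℝ) (hφ : ∀ l, φ (e l) = 1)
    (hspan : Submodule.span ℝ (Set.range e) = ⊤) {h : Fin d → ℝ}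
    (hgen : ∀ σ : Frame e, ∀ l ∉ σ, σ.height h (e l) ≠ h l) {v : E}
    (hv : ∀ σ : Frame e, ∀ l ∈ σ, σ.coord v l ≠ 0) {a : Fin d → ℝ}
    (ha : ∀ l, 0 ≤ a l) (hav : ∑ l, a l • e l = v) :
    ∃ σ : Frame e, σ.Dominates h ∧ ∀ l ∈ σ, 0 < σ.coord v l := by
  classical
  obtain ⟨σ₀, hσ₀, -⟩ := exists_frame_le_height φ hφ hspan h v a ha hav
  obtain ⟨σ, hσ, hmax⟩ := (Set.toFinite {σ : Frame e | ∀ l, 0 ≤ σ.coord v l}).exists_maximalFor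
    (fun σ => σ.height h v) _ ⟨σ₀, hσ₀⟩
  have hpos : ∀ l ∈ σ, 0 < σ.coord v l := fun l hl => (hσ l).lt_of_ne' (hv σ l hl)
  refine ⟨σ, fun k hk => ?_, hpos⟩
  by_contra hlt
  have hlt : σ.height h (e k) < h k := lt_of_le_of_ne (not_lt.1 hlt) (hgen σ k hk)
  -- a step length small enough to keep the combination nonnegative
  obtain ⟨t, ht0, ht⟩ : ∃ t > 0, ∀ l ∈ σ, t * σ.coord (e k) l ≤ σ.coord v l := by
    have h0 : ∀ᶠ t in nhdsWithin (0 : ℝ) (Set.Ioi 0), ∀ l : Fin d, l ∈ σ →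
        t * σ.coord (e k) l < σ.coord v l := by
      rw [Filter.eventually_all]
      intro l
      by_cases hl : l ∈ σ
      · have hc : Filter.Tendsto (fun t : ℝ => t * σ.coord (e k) l) (nhdsWithin 0 (Set.Ioi 0))
            (nhds (0 * σ.coord (e k) l)) :=
          ((continuous_id.mul continuous_const).tendsto 0).mono_left nhdsWithin_le_nhds
        rw [zero_mul] at hc
        filter_upwards [hc.eventually (gt_mem_nhds (hpos l hl))] with t ht _ using ht
      · exact Filter.Eventually.of_forall fun t h => absurd h hl
    obtain ⟨t, ht, ht0⟩ := (h0.and self_mem_nhdsWithin).exists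
    exact ⟨t, ht0, fun l hl => (ht l hl).le⟩
  -- trade a little of the combination on `σ` for the vector `e k` and return to a frame
  obtain ⟨τ, hτ, hle⟩ := exists_frame_le_height φ hφ hspan h v
    (fun l => σ.coord v l - t * σ.coord (e k) l + t * (Pi.single k 1 : Fin d → ℝ) l)
    (fun l => by
      have h1 : 0 ≤ t * (Pi.single k 1 : Fin d → ℝ) l := by
        refine mul_nonneg ht0.le ?_
        by_cases hlk : l = k
        · subst hlk; simp
        · simp [hlk]
      by_cases hl : l ∈ σ
      · have := ht l hl
        linarith
      · simpa [σ.coord_of_notMem _ hl] using h1)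
    (by
      simp only [add_smul, sub_smul, mul_smul, Finset.sum_add_distrib, Finset.sum_sub_distrib]
      rw [← Finset.smul_sum, ← Finset.smul_sum, σ.sum_coord, σ.sum_coord]
      simp [Pi.single_apply])
  have hval : ∑ l, h l * (σ.coord v l - t * σ.coord (e k) l +
      t * (Pi.single k 1 : Fin d → ℝ) l) = σ.height h v + t * (h k - σ.height h (e k)) := by
    simp only [mul_add, mul_sub, Finset.sum_add_distrib, Finset.sum_sub_distrib, height_apply]
    simp only [mul_left_comm _ t, ← Finset.mul_sum]
    simp [Pi.single_apply]
    ring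
  rw [hval] at hle
  have hstep : 0 < t * (h k - σ.height h (e k)) := mul_pos ht0 (by linarith)
  have := hmax (show τ ∈ {σ : Frame e | ∀ l, 0 ≤ σ.coord v l} from hτ) (by
    show σ.height h v ≤ τ.height h v
    linarith)
  have : τ.height h v ≤ σ.height h v := this
  linarith

/-- Finitely many nonzero linear forms on `ℝᵈ` are simultaneously nonzero at some positive
vector, on the moment curve. -/
theorem exists_pos_forall_sum_ne_zero {κ : Type*} [Finite κ] (p : κ → Fin d → ℝ)
    (hp : ∀ k, p k ≠ 0) : ∃ a : Fin d → ℝ, (∀ l, 0 < a l) ∧ ∀ k, ∑ l, p k l * a l ≠ 0 := by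
  classical
  let f : κ → Polynomial ℝ := fun k => ∑ l : Fin d, Polynomial.monomial (l : ℕ) (p k l)
  have hf : ∀ k, f k ≠ 0 := fun k h0 => hp k (funext fun l => by
    have := congrArg (fun q => Polynomial.coeff q (l : ℕ)) h0
    simpa [f, Polynomial.finsetSum_coeff, Polynomial.coeff_monomial, Fin.val_inj] using this)
  have hfin : (⋃ k, {t : ℝ | (f k).IsRoot t}).Finite :=
    Set.finite_iUnion fun k => Polynomial.finite_setOfPred_isRoot (hf k)
  obtain ⟨t, ht, ht'⟩ := (Set.Ioi_infinite (0 : ℝ)).exists_notMem_finite hfin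
  refine ⟨fun l => t ^ (l : ℕ), fun l => pow_pos ht _, fun k h0 => ht' ?_⟩
  refine Set.mem_iUnion.2 ⟨k, ?_⟩
  simpa [f, Polynomial.IsRoot.def, Polynomial.eval_finsetSum] using h0

end Frame

end Frames

/-! ### Shifted cones -/

/-- A graded cone with a regular triangulation and a shift. The cone is spanned by the images in a
real vector space `E` of lattice points `e l` of degree one, the generic heights `h` define a
regular triangulation of it, and the shift `u` moves no lattice point onto a wall between
simplicial cones. The shifted semigroup module has as a basis the monomials `x ^ n` for the lattice
points `n` such that `n + u` lies in the cone; small shifts into and out of the cone give the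
semigroup ring and its ideal of interior points. -/
structure ShiftedCone (N E : Type*) [AddCommGroup N] [AddCommGroup E] [Module ℝ E] (d : ℕ) where
  /-- The map from the lattice to the real vector space. -/
  toE : N →+ E
  /-- The generators of the cone. -/
  e : Fin d → N
  /-- Additive maps on the lattice extend to `E`, as for the extension of scalars of the lattice. -/
  exists_extend : ∀ g : N →+ ℂ, ∃ G : E →ₗ[ℝ] ℂ, ∀ n, G (toE n) = g n
  /-- The grading of the lattice. -/
  deg : N →+ ℤ
  /-- The real extension of the grading. -/
  degE : E →ₗ[ℝ] ℝ
  degE_toE : ∀ n, degE (toE n) = deg n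
  deg_e : ∀ l, deg (e l) = 1
  span_eq_top : Submodule.span ℝ (Set.range fun l => toE (e l)) = ⊤
  /-- The heights of the generators. -/
  h : Fin d → ℝ
  /-- The heights are generic: no generator outside a frame lies on the graph of its linear form. -/
  height_ne : ∀ σ : Frame fun l => toE (e l), ∀ l ∉ σ, σ.height h (toE (e l)) ≠ h l
  /-- The shift. -/
  u : E
  /-- No shifted lattice point lies on a wall. -/
  coord_ne : ∀ (σ : Frame fun l => toE (e l)) (n : N), ∀ l ∈ σ, σ.coord (toE n + u) l ≠ 0
  /-- The half-open fundamental boxes contain finitely many shifted lattice points. -/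
  finite_box : ∀ σ : Frame fun l => toE (e l),
    {n : N | ∀ l, 0 ≤ σ.coord (toE n + u) l ∧ σ.coord (toE n + u) l < 1}.Finite

namespace ShiftedCone

variable {N E : Type*} [AddCommGroup N] [AddCommGroup E] [Module ℝ E] {d : ℕ}
  (C : ShiftedCone N E d)

/-- The generators of the cone in the real vector space. -/
abbrev vec (l : Fin d) : E := C.toE (C.e l)

theorem degE_vec (l : Fin d) : C.degE (C.vec l) = 1 := by
  rw [vec, C.degE_toE, C.deg_e, Int.cast_one]

instance : Nonempty (Frame C.vec) := by
  obtain ⟨σ, -⟩ := Frame.exists_frame_le_height (e := C.vec) C.degE C.degE_vec C.span_eq_top 0 0 0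
    (fun _ => le_rfl) (by simp)
  exact ⟨σ⟩

/-- The lattice points whose shift lies in the cone. -/
def points : Set N :=
  {n | ∃ a : Fin d → ℝ, (∀ l, 0 ≤ a l) ∧ ∑ l, a l • C.vec l = C.toE n + C.u}

/-- The simplicial cone of the triangulation that contains the shift of a lattice point. It is
meaningful only for the lattice points in `C.points`. -/
def cell (n : N) : Frame C.vec :=
  Classical.epsilon fun σ : Frame C.vec =>
    σ.Dominates C.h ∧ ∀ l ∈ σ, 0 < σ.coord (C.toE n + C.u) l

variable {C}

theorem cell_spec {n : N} (hn : n ∈ C.points) : (C.cell n).Dominates C.h ∧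
    ∀ l ∈ C.cell n, 0 < (C.cell n).coord (C.toE n + C.u) l := by
  obtain ⟨a, ha, hav⟩ := hn
  exact Classical.epsilon_spec (Frame.exists_dominates C.degE C.degE_vec C.span_eq_top
    C.height_ne (fun σ => C.coord_ne σ n) ha hav)

theorem cell_eq {n : N} {σ : Frame C.vec} (hσ : σ.Dominates C.h)
    (hpos : ∀ l ∈ σ, 0 < σ.coord (C.toE n + C.u) l) : C.cell n = σ := by
  by_contra hne
  have hspec := Classical.epsilon_spec (p := fun σ : Frame C.vec =>
    σ.Dominates C.h ∧ ∀ l ∈ σ, 0 < σ.coord (C.toE n + C.u) l) ⟨σ, hσ, hpos⟩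
  exact lt_asymm (hσ.height_lt hne hspec.2) (hspec.1.height_lt (Ne.symm hne) hpos)

theorem coord_nonneg {n : N} (hn : n ∈ C.points) (l : Fin d) :
    0 ≤ (C.cell n).coord (C.toE n + C.u) l := by
  by_cases hl : l ∈ C.cell n
  · exact ((cell_spec hn).2 l hl).le
  · exact ((C.cell n).coord_of_notMem _ hl).ge

theorem mem_points_of_coord_nonneg {n : N} (σ : Frame C.vec)
    (h : ∀ l, 0 ≤ σ.coord (C.toE n + C.u) l) : n ∈ C.points :=
  ⟨_, h, σ.sum_coord _⟩

theorem add_mem_points {n : N} (hn : n ∈ C.points) (l : Fin d) : n + C.e l ∈ C.points := by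
  obtain ⟨a, ha, hav⟩ := hn
  refine ⟨a + Pi.single l 1, fun k => add_nonneg (ha k) ?_, ?_⟩
  · by_cases hk : k = l
    · subst hk; simp
    · simp [hk]
  · simp only [Pi.add_apply, add_smul, Finset.sum_add_distrib, hav, map_add]
    simp [Pi.single_apply, add_right_comm]

variable (C) in
/-- The piecewise linear concave function of the triangulation at the shift of a lattice point. -/
def weight (n : N) : ℝ := (C.cell n).height C.h (C.toE n + C.u)

theorem weight_add_eq {n : N} (l : Fin d) : C.weight (n + C.e l) =
    (C.cell (n + C.e l)).height C.h (C.toE n + C.u) +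
      (C.cell (n + C.e l)).height C.h (C.vec l) := by
  rw [weight, ← map_add]
  congr 1
  rw [map_add]
  abel

/-- Superadditivity of the weight. -/
theorem weight_add_le {n : N} (hn : n ∈ C.points) (l : Fin d) :
    C.weight n + C.h l ≤ C.weight (n + C.e l) := by
  rw [weight_add_eq]
  refine add_le_add ?_ ((cell_spec (add_mem_points hn l)).1.le l)
  by_cases hc : C.cell n = C.cell (n + C.e l)
  · rw [← hc]; rfl
  · exact ((cell_spec (add_mem_points hn l)).1.height_lt hc (cell_spec hn).2).le

/-- The weight is additive only within a simplicial cone of the triangulation. -/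
theorem mem_cell_of_weight_add_eq {n : N} (hn : n ∈ C.points) {l : Fin d}
    (hw : C.weight n + C.h l = C.weight (n + C.e l)) : l ∈ C.cell n := by
  have hspec := cell_spec (add_mem_points hn l)
  rw [weight_add_eq] at hw
  have h1 := hspec.1.le l
  by_cases hc : C.cell n = C.cell (n + C.e l)
  · by_contra hl
    rw [hc] at hl
    have := hspec.1 l hl
    rw [weight, hc] at hw
    linarith
  · have := hspec.1.height_lt hc (cell_spec hn).2
    rw [weight] at hw
    linarith

theorem coord_add_sum {σ : Frame C.vec} (n : N) {k : Fin d → ℕ} (hk : ∀ l ∉ σ, k l = 0)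
    (l : Fin d) : σ.coord (C.toE (n + ∑ l, k l • C.e l) + C.u) l =
      σ.coord (C.toE n + C.u) l + k l := by
  have h1 : C.toE (n + ∑ l, k l • C.e l) + C.u =
      (C.toE n + C.u) + ∑ l, (k l : ℝ) • C.vec l := by
    rw [map_add, map_sum]
    simp only [map_nsmul, Nat.cast_smul_eq_nsmul]
    abel
  rw [h1, map_add, σ.coord_sum fun l hl => by simp [hk l hl]]
  simp

theorem cell_add_sum {n : N} (hn : n ∈ C.points) {k : Fin d → ℕ}
    (hk : ∀ l ∉ C.cell n, k l = 0) : C.cell (n + ∑ l, k l • C.e l) = C.cell n := by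
  refine cell_eq (cell_spec hn).1 fun l hl => ?_
  rw [coord_add_sum n hk]
  have := (cell_spec hn).2 l hl
  positivity

theorem cell_add {n : N} (hn : n ∈ C.points) {l : Fin d} (hl : l ∈ C.cell n) :
    C.cell (n + C.e l) = C.cell n := by
  have := cell_add_sum hn (k := Pi.single l 1) fun k hk => by
    rw [Pi.single_apply, if_neg]
    rintro rfl
    exact hk hl
  simpa [Pi.single_apply] using this

theorem weight_add {n : N} (hn : n ∈ C.points) {l : Fin d} (hl : l ∈ C.cell n) :
    C.weight (n + C.e l) = C.weight n + C.h l := by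
  rw [weight_add_eq, cell_add hn hl, (C.cell n).height_self C.h hl, weight]

variable (C) in
/-- The integral parts of the coordinates of the shift of a lattice point. -/
def exps (n : N) (l : Fin d) : ℕ := ⌊(C.cell n).coord (C.toE n + C.u) l⌋₊

variable (C) in
/-- The point of the half-open fundamental box to which a lattice point reduces. -/
def base (n : N) : N := n - ∑ l, C.exps n l • C.e l

theorem base_add_sum (n : N) : C.base n + ∑ l, C.exps n l • C.e l = n := sub_add_cancel _ _

theorem exps_of_notMem {n : N} {l : Fin d} (hl : l ∉ C.cell n) : C.exps n l = 0 := by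
  simp [exps, (C.cell n).coord_of_notMem _ hl]

theorem coord_base (n : N) (l : Fin d) : (C.cell n).coord (C.toE (C.base n) + C.u) l =
    (C.cell n).coord (C.toE n + C.u) l - C.exps n l := by
  have := coord_add_sum (C := C) (C.base n) (k := C.exps n) (fun l hl => exps_of_notMem hl) l
  rw [base_add_sum] at this
  linarith

theorem coord_base_nonneg {n : N} (hn : n ∈ C.points) (l : Fin d) :
    0 ≤ (C.cell n).coord (C.toE (C.base n) + C.u) l := by
  rw [coord_base, sub_nonneg]
  exact Nat.floor_le (coord_nonneg hn l)

theorem base_mem {n : N} (hn : n ∈ C.points) : C.base n ∈ C.points :=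
  mem_points_of_coord_nonneg (C.cell n) (coord_base_nonneg hn)

theorem cell_base {n : N} (hn : n ∈ C.points) : C.cell (C.base n) = C.cell n :=
  cell_eq (cell_spec hn).1 fun l hl =>
    (coord_base_nonneg hn l).lt_of_ne' (C.coord_ne _ _ l hl)

variable (C) in
/-- The lattice points whose shift lies in the half-open fundamental box of its cell. They index
the basis of the shifted semigroup module over the polynomial ring. -/
def box : Set N := {n ∈ C.points | ∀ l, C.exps n l = 0}

theorem base_mem_box {n : N} (hn : n ∈ C.points) : C.base n ∈ C.box := by
  refine ⟨base_mem hn, fun l => ?_⟩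
  rw [exps, cell_base hn, coord_base, Nat.floor_eq_zero, exps, sub_lt_iff_lt_add']
  exact Nat.lt_floor_add_one _

theorem box_finite : C.box.Finite := by
  refine (Set.finite_iUnion C.finite_box).subset fun n hn => Set.mem_iUnion.2 ⟨C.cell n, fun l => ?_⟩
  exact ⟨coord_nonneg hn.1 l, Nat.floor_eq_zero.1 (hn.2 l)⟩

section BoxPoint

variable {b : N} (hb : b ∈ C.box) {k : Fin d → ℕ} (hk : ∀ l ∉ C.cell b, k l = 0)
include hb hk

theorem exps_add_sum : C.exps (b + ∑ l, k l • C.e l) = k := by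
  funext l
  rw [exps, cell_add_sum hb.1 hk, coord_add_sum b hk, Nat.floor_add_natCast (coord_nonneg hb.1 l)]
  have := hb.2 l
  rw [exps] at this
  omega

theorem base_add_sum_eq : C.base (b + ∑ l, k l • C.e l) = b := by
  rw [base, exps_add_sum hb hk, add_sub_cancel_right]

end BoxPoint

theorem add_sum_mem_points {n : N} (hn : n ∈ C.points) (k : Fin d → ℕ) :
    n + ∑ l, k l • C.e l ∈ C.points := by
  obtain ⟨a, ha, hav⟩ := hn
  refine ⟨fun l => a l + k l, fun l => add_nonneg (ha l) (Nat.cast_nonneg _), ?_⟩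
  simp only [add_smul, Finset.sum_add_distrib, hav, map_add, map_sum, map_nsmul,
    Nat.cast_smul_eq_nsmul]
  abel

theorem deg_add_sum (n : N) (k : Fin d → ℕ) :
    C.deg (n + ∑ l, k l • C.e l) = C.deg n + ∑ l, (k l : ℤ) := by
  simp [map_sum, C.deg_e]

variable (C) in
/-- The shifted semigroup module has finite-dimensional homogeneous components and vanishes in
sufficiently negative degrees. -/
theorem finite_points_le (D : ℤ) : {n ∈ C.points | C.deg n ≤ D}.Finite := by
  obtain ⟨m, hm⟩ := (C.box_finite.image C.deg).bddBelow
  refine ((C.box_finite.prod (Set.finite_Iic (fun _ : Fin d => (D - m).toNat))).image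
    fun p => p.1 + ∑ l, p.2 l • C.e l).subset ?_
  rintro n ⟨hn, hD⟩
  refine ⟨(C.base n, C.exps n), ⟨base_mem_box hn, fun l => ?_⟩, base_add_sum n⟩
  have h1 : m ≤ C.deg (C.base n) := hm ⟨_, base_mem_box hn, rfl⟩
  have h2 := deg_add_sum (C := C) (C.base n) (C.exps n)
  rw [base_add_sum] at h2
  have h3 : (C.exps n l : ℤ) ≤ ∑ l, (C.exps n l : ℤ) :=
    Finset.single_le_sum (f := fun l => (C.exps n l : ℤ)) (fun l _ => by positivity)
      (Finset.mem_univ l)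
  simp only
  omega

/-- Walking from a lattice point into its cell one generator at a time. -/
theorem cell_induction {b : N} (hb : b ∈ C.points) {motive : N → (Fin d → ℕ) → Prop}
    (zero : motive b 0)
    (step : ∀ n k l, n ∈ C.points → C.cell n = C.cell b → l ∈ C.cell b → motive n k →
      motive (n + C.e l) (k + Pi.single l 1)) {k : Fin d → ℕ} (hk : ∀ l ∉ C.cell b, k l = 0) :
    motive (b + ∑ l, k l • C.e l) k := by
  induction hn : ∑ l, k l generalizing k with
  | zero =>
    have : k = 0 := funext fun l => by
      simpa using (Finset.sum_eq_zero_iff.1 hn) l (Finset.mem_univ l)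
    subst this
    simpa using zero
  | succ m ih =>
    obtain ⟨l, hl⟩ : ∃ l, k l ≠ 0 := by
      by_contra! H
      simp [H] at hn
    have hle : Pi.single l 1 ≤ k := by
      intro j
      by_cases hj : j = l
      · subst hj; simpa using Nat.one_le_iff_ne_zero.2 hl
      · simp [hj]
    obtain ⟨k', rfl⟩ : ∃ k', k = k' + Pi.single l 1 :=
      ⟨k - Pi.single l 1, (tsub_add_cancel_of_le hle).symm⟩
    have hk' : ∀ l ∉ C.cell b, k' l = 0 := fun j hj => by
      have := hk j hj
      simp only [Pi.add_apply] at this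
      omega
    have hlb : l ∈ C.cell b := by
      by_contra h
      exact hl (hk l h)
    have := step _ k' l (add_sum_mem_points hb k') (cell_add_sum hb hk') hlb (ih hk' (by
      simp only [Pi.add_apply, Finset.sum_add_distrib, Finset.sum_pi_single', Finset.mem_univ,
        if_true] at hn
      omega))
    convert! this using 1
    simp [add_smul, Finset.sum_add_distrib, Pi.single_apply, add_assoc]

end ShiftedCone

/-! ### The elements attached to lattice points and their degeneration -/

namespace ShiftedCone

variable {N E : Type*} [AddCommGroup N] [AddCommGroup E] [Module ℝ E] {d : ℕ}
  {C : ShiftedCone N E d}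

section Elements

variable {S : Type*} [CommRing S] [Algebra ℂ S]

/-- The linear element `∑ p, ⟨λ, e p⟩ c p x ^ (e p)` of the group ring of `N`, for the `l`-th
coordinate function `λ` of a frame. -/
def coordElement (σ : Frame C.vec) (c : Fin d → S) (l : Fin d) : AddMonoidAlgebra S N :=
  ∑ p, AddMonoidAlgebra.single (C.e p) (algebraMap ℂ S (σ.coord (C.vec p) l : ℝ) * c p)

/-- A monomial in the coordinate elements of a frame. -/
def coordMonomial (σ : Frame C.vec) (c : Fin d → S) (k : Fin d → ℕ) : AddMonoidAlgebra S N :=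
  ∏ l, coordElement σ c l ^ k l

theorem coordMonomial_zero (σ : Frame C.vec) (c : Fin d → S) : coordMonomial σ c 0 = 1 := by
  simp [coordMonomial]

theorem coordMonomial_add_single (σ : Frame C.vec) (c : Fin d → S) (k : Fin d → ℕ) (l : Fin d) :
    coordMonomial σ c (k + Pi.single l 1) = coordElement σ c l * coordMonomial σ c k := by
  simp only [coordMonomial, Pi.add_apply, pow_add, Finset.prod_mul_distrib]
  rw [mul_comm]
  congr 1
  rw [Finset.prod_eq_single l]
  · simp
  · intro j _ hj
    simp [hj]
  · simp

variable (C) in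
/-- The element attached to a lattice point: the monomial of its base point times the monomial in
the coordinate elements of its cell prescribed by its exponents. In the degeneration of the
semigroup module to the triangulation it becomes the monomial of the lattice point. -/
def element (c : Fin d → S) (n : N) : AddMonoidAlgebra S N :=
  AddMonoidAlgebra.single (C.base n) 1 * coordMonomial (C.cell n) c (C.exps n)

theorem coeff_coordElement_mul (σ : Frame C.vec) (c : Fin d → S) (l : Fin d)
    (f : AddMonoidAlgebra S N) (m : N) : (coordElement σ c l * f).coeff m =
      ∑ p, algebraMap ℂ S (σ.coord (C.vec p) l : ℝ) * c p * f.coeff (m - C.e p) := by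
  rw [coordElement, Finset.sum_mul, AddMonoidAlgebra.coeff_sum, Finset.sum_apply']
  refine Finset.sum_congr rfl fun p _ => ?_
  rw [AddMonoidAlgebra.coeff_single_mul_apply, neg_add_eq_sub]

theorem map_coordElement {S' : Type*} [CommRing S'] [Algebra ℂ S'] (f : S →ₐ[ℂ] S')
    (σ : Frame C.vec) (c : Fin d → S) (l : Fin d) :
    AddMonoidAlgebra.mapRingHom N (f : S →+* S') (coordElement σ c l) =
      coordElement σ (fun p => f (c p)) l := by
  simp [coordElement, map_sum]

theorem map_element {S' : Type*} [CommRing S'] [Algebra ℂ S'] (f : S →ₐ[ℂ] S') (c : Fin d → S)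
    (n : N) : AddMonoidAlgebra.mapRingHom N (f : S →+* S') (C.element c n) =
      C.element (fun p => f (c p)) n := by
  simp only [element, coordMonomial, map_mul, map_prod, map_pow, map_coordElement]
  simp

variable (C) in
/-- Homogeneous elements of degree `j` of the shifted semigroup module, as elements of the group
ring. -/
def IsHomogeneous (f : AddMonoidAlgebra S N) (j : ℤ) : Prop :=
  ∀ m, f.coeff m ≠ 0 → m ∈ C.points ∧ C.deg m = j

theorem IsHomogeneous.coordElement_mul {f : AddMonoidAlgebra S N} {j : ℤ}
    (hf : C.IsHomogeneous f j) (σ : Frame C.vec) (c : Fin d → S) (l : Fin d) :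
    C.IsHomogeneous (coordElement σ c l * f) (j + 1) := by
  intro m hm
  rw [coeff_coordElement_mul] at hm
  obtain ⟨p, -, hp⟩ := Finset.exists_ne_zero_of_sum_ne_zero hm
  obtain ⟨h1, h2⟩ := hf _ (right_ne_zero_of_mul hp)
  have h3 := add_mem_points h1 p
  rw [sub_add_cancel] at h3
  refine ⟨h3, ?_⟩
  rw [map_sub, C.deg_e] at h2
  omega

theorem IsHomogeneous.mul_coordMonomial {f : AddMonoidAlgebra S N} {j : ℤ}
    (hf : C.IsHomogeneous f j) (σ : Frame C.vec) (c : Fin d → S) (k : Fin d → ℕ) :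
    C.IsHomogeneous (f * coordMonomial σ c k) (j + ∑ l, (k l : ℤ)) := by
  have hpow : ∀ (l : Fin d) (i : ℕ) (f : AddMonoidAlgebra S N) (j : ℤ), C.IsHomogeneous f j →
      C.IsHomogeneous (f * coordElement σ c l ^ i) (j + (i : ℤ)) := by
    intro l i f j hf
    induction i with
    | zero => simpa using hf
    | succ i ih =>
      rw [pow_succ', mul_left_comm, Nat.cast_succ, ← add_assoc]
      exact ih.coordElement_mul σ c l
  unfold coordMonomial
  induction (Finset.univ : Finset (Fin d)) using Finset.induction_on with
  | empty => simpa using hf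
  | insert l s hl ih =>
    rw [Finset.prod_insert hl, Finset.sum_insert hl, mul_comm (_ ^ _), ← mul_assoc,
      add_comm (k l : ℤ), ← add_assoc]
    exact hpow _ _ _ _ ih

omit [Algebra ℂ S] in
theorem isHomogeneous_single {b : N} (hb : b ∈ C.points) (a : S) :
    C.IsHomogeneous (AddMonoidAlgebra.single b a) (C.deg b) := by
  intro m hm
  rw [AddMonoidAlgebra.coeff_single] at hm
  obtain rfl : b = m := by
    by_contra h
    exact hm (Finsupp.single_eq_of_ne (Ne.symm h))
  exact ⟨hb, rfl⟩

theorem isHomogeneous_element (c : Fin d → S) {n : N} (hn : n ∈ C.points) :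
    C.IsHomogeneous (C.element c n) (C.deg n) := by
  have h := (isHomogeneous_single (base_mem hn) (1 : S)).mul_coordMonomial (C.cell n) c (C.exps n)
  rwa [← deg_add_sum, base_add_sum] at h

end Elements

section Degeneration

variable (C) in
/-- The one-parameter family of coefficients given by the heights. -/
def heightCoeff (T : ℝ) (l : Fin d) : ℂ := ((T ^ C.h l : ℝ) : ℂ)

/-- After rescaling by the weights, the elements for the coefficients `T ^ h l` tend to the
monomials as `T` tends to infinity: all other terms have strictly smaller weight, since the weight
is additive only along the cells. -/
theorem tendsto_coeff_element [DecidableEq N] {n m : N} (hn : n ∈ C.points) (hm : m ∈ C.points) :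
    Filter.Tendsto (fun T : ℝ => ((T ^ (C.weight (C.base n) - C.weight m) : ℝ) : ℂ) *
      (C.element (C.heightCoeff T) n).coeff m) Filter.atTop (𝓝 (if m = n then 1 else 0)) := by
  set b := C.base n with hb
  have hbQ : b ∈ C.points := base_mem hn
  have hcell : C.cell b = C.cell n := cell_base hn
  have key := cell_induction hbQ (motive := fun n' k => n' ∈ C.points → ∀ m ∈ C.points,
    Filter.Tendsto (fun T : ℝ => ((T ^ (C.weight b - C.weight m) : ℝ) : ℂ) *
      (AddMonoidAlgebra.single b 1 * coordMonomial (C.cell n) (C.heightCoeff T) k).coeff m)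
      Filter.atTop (𝓝 (if m = n' then 1 else 0))) (k := C.exps n) ?_ ?_ (by
        rw [hcell]; exact fun l hl => exps_of_notMem hl)
  · rw [base_add_sum] at key
    exact key hn m hm
  · intro _ m _
    simp only [coordMonomial_zero, mul_one, AddMonoidAlgebra.coeff_single]
    by_cases h : m = b
    · subst h
      simp
    · simp [h, Finsupp.single_eq_of_ne h]
  · intro n' k l hn' hc hl ih _ m hm
    simp only [coordMonomial_add_single, mul_left_comm (AddMonoidAlgebra.single b (1 : ℂ)),
      coeff_coordElement_mul, Finset.mul_sum]
    have hlim : (if m = n' + C.e l then (1 : ℂ) else 0) =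
        ∑ p, if p = l ∧ m = n' + C.e l then (1 : ℂ) else 0 := by
      by_cases h : m = n' + C.e l <;> simp [h]
    rw [hlim]
    refine tendsto_finsetSum _ fun p _ => ?_
    by_cases hmp : m - C.e p ∈ C.points
    · have hle := weight_add_le hmp p
      rw [sub_add_cancel] at hle
      have hlim1 := ih hn' _ hmp
      -- the excess of the weight along the step by `e p`
      set δ := C.h p + C.weight (m - C.e p) - C.weight m with hδ
      have hlim2 : Filter.Tendsto (fun T : ℝ => ((T ^ δ : ℝ) : ℂ)) Filter.atTop
          (𝓝 (if δ = 0 then 1 else 0)) := by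
        by_cases h0 : δ = 0
        · simp [h0]
        · have : Filter.Tendsto (fun T : ℝ => T ^ (-(-δ))) Filter.atTop (𝓝 0) :=
            tendsto_rpow_neg_atTop (by
              have : δ < 0 := lt_of_le_of_ne (by linarith) h0
              linarith)
          rw [neg_neg] at this
          rw [if_neg h0]
          exact_mod_cast (Complex.continuous_ofReal.tendsto 0).comp this
      have hlim3 := (hlim2.mul hlim1).const_mul ((C.cell n).coord (C.vec p) l : ℂ)
      have heq : ((C.cell n).coord (C.vec p) l : ℂ) * ((if δ = 0 then (1 : ℂ) else 0) *
          if m - C.e p = n' then 1 else 0) = if p = l ∧ m = n' + C.e l then 1 else 0 := by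
        by_cases h1 : m - C.e p = n'
        · have hm' : m = n' + C.e p := by rw [← h1, sub_add_cancel]
          by_cases h0 : δ = 0
          · have hp : p ∈ C.cell n' := mem_cell_of_weight_add_eq hn' (by
              rw [← hm', ← h1]
              linarith)
            rw [hc, hcell] at hp
            rw [if_pos h0, if_pos h1, (C.cell n).coord_self hp]
            by_cases hpl : p = l
            · subst hpl
              simp [hm']
            · simp [hpl, Ne.symm hpl]
          · have : ¬(p = l ∧ m = n' + C.e l) := by
              rintro ⟨rfl, -⟩
              have := weight_add hn' (hc ▸ hl)
              rw [← hm', ← h1] at this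
              exact h0 (by rw [hδ]; linarith)
            simp [h0, this]
        · have : ¬(p = l ∧ m = n' + C.e l) := by
            rintro ⟨rfl, rfl⟩
            exact h1 (add_sub_cancel_right _ _)
          simp [h1, this]
      rw [heq] at hlim3
      refine hlim3.congr' ?_
      filter_upwards [Filter.eventually_gt_atTop (0 : ℝ)] with T hT
      have hexp : T ^ (C.weight b - C.weight m) * T ^ C.h p =
          T ^ δ * T ^ (C.weight b - C.weight (m - C.e p)) := by
        rw [← Real.rpow_add hT, ← Real.rpow_add hT]
        congr 1
        rw [hδ]
        ring
      have hexp' : ((T ^ (C.weight b - C.weight m) : ℝ) : ℂ) * ((T ^ C.h p : ℝ) : ℂ) =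
          ((T ^ δ : ℝ) : ℂ) * ((T ^ (C.weight b - C.weight (m - C.e p)) : ℝ) : ℂ) := by
        exact_mod_cast hexp
      simp only [heightCoeff, Algebra.algebraMap_self, RingHom.id_apply]
      linear_combination (-(((C.cell n).coord (C.vec p) l : ℝ) : ℂ) *
        (AddMonoidAlgebra.single b 1 *
          coordMonomial (C.cell n) (C.heightCoeff T) k).coeff (m - C.e p)) * hexp'
    · have hne : ¬(p = l ∧ m = n' + C.e l) := by
        rintro ⟨rfl, rfl⟩
        rw [add_sub_cancel_right] at hmp
        exact hmp hn'
      rw [if_neg hne]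
      refine tendsto_const_nhds.congr fun T => ?_
      have : (AddMonoidAlgebra.single b 1 *
          coordMonomial (C.cell n) (C.heightCoeff T) k).coeff (m - C.e p) = 0 := by
        by_contra h
        exact hmp (((isHomogeneous_single hbQ (1 : ℂ)).mul_coordMonomial (C.cell n)
          (C.heightCoeff T) k) _ h).1
      rw [this, mul_zero, mul_zero]

end Degeneration

end ShiftedCone

/-! ### The generic determinant -/

namespace ShiftedCone

variable {N E : Type*} [AddCommGroup N] [AddCommGroup E] [Module ℝ E] {d : ℕ}
  {C : ShiftedCone N E d}

section Determinant

variable (C) in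
/-- The coefficients at a finite set of monomials of the elements attached to the same set of
lattice points. -/
def elementMatrix {S : Type*} [CommRing S] [Algebra ℂ S] (c : Fin d → S) (G : Finset N) :
    Matrix G G S :=
  Matrix.of fun m n => (C.element c n).coeff m

variable (C) in
/-- The determinant of the coefficients of the elements, as a polynomial in the coefficients of the
linear elements. -/
def detPolynomial [DecidableEq N] (G : Finset N) : MvPolynomial (Fin d) ℂ :=
  (C.elementMatrix (MvPolynomial.X : Fin d → MvPolynomial (Fin d) ℂ) G).det

theorem eval_detPolynomial [DecidableEq N] (c : Fin d → ℂ) (G : Finset N) :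
    MvPolynomial.eval c (C.detPolynomial G) = (C.elementMatrix c G).det := by
  rw [detPolynomial, RingHom.map_det]
  have : (MvPolynomial.eval c).mapMatrix
      (C.elementMatrix (MvPolynomial.X : Fin d → MvPolynomial (Fin d) ℂ) G) =
        C.elementMatrix c G := by
    ext m n
    have h := map_element (C := C) (MvPolynomial.aeval c : MvPolynomial (Fin d) ℂ →ₐ[ℂ] ℂ)
      (MvPolynomial.X) n
    simp only [MvPolynomial.aeval_X] at h
    have h' := congrArg (fun x : AddMonoidAlgebra ℂ N => x.coeff m) h
    simp only [elementMatrix, RingHom.mapMatrix_apply, Matrix.map_apply, Matrix.of_apply]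
    rw [← h']
    simp
  rw [this]

/-- The determinant polynomial does not vanish at the coefficients `T ^ h l` for large `T`. -/
theorem detPolynomial_ne_zero [DecidableEq N] {G : Finset N} (hG : ∀ n ∈ G, n ∈ C.points) :
    C.detPolynomial G ≠ 0 := by
  -- rescaling rows and columns by the weights, the matrix tends to the identity
  have hlim : Filter.Tendsto (fun T : ℝ => (Matrix.of fun m n : G =>
      ((T ^ (C.weight (C.base n) - C.weight m) : ℝ) : ℂ) *
        C.elementMatrix (C.heightCoeff T) G m n)) Filter.atTop (𝓝 1) := by
    refine tendsto_pi_nhds.2 fun m => tendsto_pi_nhds.2 fun n => ?_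
    have := tendsto_coeff_element (C := C) (hG n n.2) (hG m m.2)
    rw [Matrix.one_apply]
    simp only [Subtype.ext_iff]
    exact this
  have hdet : Filter.Tendsto (fun T : ℝ => (Matrix.of fun m n : G =>
      ((T ^ (C.weight (C.base n) - C.weight m) : ℝ) : ℂ) *
        C.elementMatrix (C.heightCoeff T) G m n).det) Filter.atTop (𝓝 1) := by
    have := ((continuous_id (X := Matrix G G ℂ)).matrix_det.tendsto 1).comp hlim
    simpa [Function.comp_def] using this
  obtain ⟨T, hT, hT0⟩ := ((hdet.eventually_ne one_ne_zero).and
    (Filter.eventually_gt_atTop (0 : ℝ))).exists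
  intro h0
  have hzero : (C.elementMatrix (C.heightCoeff T) G).det = 0 := by
    rw [← eval_detPolynomial, h0, map_zero]
  have hscale : (Matrix.of fun m n : G =>
      ((T ^ (C.weight (C.base n) - C.weight m) : ℝ) : ℂ) *
        C.elementMatrix (C.heightCoeff T) G m n) = Matrix.of fun m n : G =>
      ((T ^ (-C.weight m) : ℝ) : ℂ) * (Matrix.of fun m n : G =>
        ((T ^ C.weight (C.base n) : ℝ) : ℂ) * C.elementMatrix (C.heightCoeff T) G m n) m n := by
    ext m n
    rw [Matrix.of_apply, Matrix.of_apply, Matrix.of_apply, ← mul_assoc, ← Complex.ofReal_mul,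
      ← Real.rpow_add hT0, neg_add_eq_sub]
  rw [hscale, Matrix.det_mul_column (fun m : G => ((T ^ (-C.weight m) : ℝ) : ℂ)),
    Matrix.det_mul_row (fun n : G => ((T ^ C.weight (C.base n) : ℝ) : ℂ)), hzero] at hT
  simp at hT

/-- Where the determinant polynomial of the degrees up to `D` does not vanish, all monomials of
these degrees are combinations of the elements. -/
theorem single_mem_span_element [DecidableEq N] {c : Fin d → ℂ} {G : Finset N} {D : ℤ}
    (hG : ∀ n, n ∈ G ↔ n ∈ C.points ∧ C.deg n ≤ D)
    (hc : MvPolynomial.eval c (C.detPolynomial G) ≠ 0) {m : N} (hm : m ∈ G) :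
    AddMonoidAlgebra.single m 1 ∈ Submodule.span ℂ (C.element c '' C.points) := by
  rw [eval_detPolynomial] at hc
  set A := C.elementMatrix c G with hA
  have hinv : A * A⁻¹ = 1 := Matrix.mul_nonsing_inv _ hc.isUnit
  have hsum : AddMonoidAlgebra.single m (1 : ℂ) = ∑ n : G, A⁻¹ n ⟨m, hm⟩ • C.element c n := by
    ext m'
    rw [AddMonoidAlgebra.coeff_sum, Finset.sum_apply']
    by_cases hm' : m' ∈ G
    · have := congrFun (congrFun hinv ⟨m', hm'⟩) ⟨m, hm⟩
      rw [Matrix.mul_apply] at this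
      simp only [hA, elementMatrix, Matrix.of_apply, Matrix.one_apply, Subtype.mk.injEq] at this
      rw [AddMonoidAlgebra.coeff_single, Finsupp.single_apply]
      simp only [AddMonoidAlgebra.coeff_smul, Finsupp.smul_apply, smul_eq_mul]
      rw [eq_comm] at this
      simp only [eq_comm (a := m)]
      rw [this]
      exact Finset.sum_congr rfl fun n _ => mul_comm _ _
    · rw [AddMonoidAlgebra.coeff_single, Finsupp.single_eq_of_ne (by rintro rfl; exact hm' hm)]
      refine (Finset.sum_eq_zero fun n _ => ?_).symm
      have : (C.element c n).coeff m' = 0 := by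
        by_contra h
        have hn := (hG n).1 n.2
        obtain ⟨h1, h2⟩ := isHomogeneous_element c hn.1 m' h
        exact hm' ((hG m').2 ⟨h1, h2 ▸ hn.2⟩)
      simp [this]
  rw [hsum]
  exact Submodule.sum_mem _ fun n _ => Submodule.smul_mem _ _
    (Submodule.subset_span ⟨n, ((hG n).1 n.2).1, rfl⟩)

/-- If the elements span the semigroup module, then they are linearly independent, since they are
homogeneous and are as many as the monomials in each degree. -/
theorem linearIndepOn_element {c : Fin d → ℂ} (hc : ∀ m ∈ C.points,
      AddMonoidAlgebra.single m 1 ∈ Submodule.span ℂ (C.element c '' C.points)) :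
    LinearIndepOn ℂ (C.element c) C.points := by
  classical
  refine linearIndepOn_of_finite _ fun t ht htfin => ?_
  obtain ⟨D, hD⟩ := (htfin.image C.deg).bddAbove
  set G := (C.finite_points_le D).toFinset with hGdef
  have hG : ∀ n, n ∈ G ↔ n ∈ C.points ∧ C.deg n ≤ D := fun n => by simp [hGdef]
  suffices h : LinearIndepOn ℂ (C.element c) (G : Set N) from
    h.mono fun n hn => (hG n).2 ⟨ht hn, hD ⟨n, hn, rfl⟩⟩
  have hex : ∀ m ∈ G, ∃ a : N →₀ ℂ, (∀ n ∈ a.support, n ∈ C.points) ∧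
      a.sum (fun n z => z • C.element c n) = AddMonoidAlgebra.single m 1 := by
    intro m hm
    obtain ⟨a, ha, hsum⟩ := (Finsupp.mem_span_image_iff_linearCombination ℂ).1
      (hc m ((hG m).1 hm).1)
    exact ⟨a, fun n hn => (Finsupp.mem_supported ℂ a).1 ha hn, hsum⟩
  choose! a ha hsum using hex
  set A := C.elementMatrix c G with hA
  -- Elements of degree above `D` do not contribute to the coefficients at `G`, so the expressions
  -- of the monomials in the elements give a one-sided inverse of a square matrix.
  have hinv : A * (Matrix.of fun n m : G => a m n) = 1 := by
    ext m' m
    rw [Matrix.mul_apply]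
    have h1 := congrArg (fun x => AddMonoidAlgebra.coeff x (m' : N)) (hsum m m.2)
    simp only [AddMonoidAlgebra.coeff_single, Finsupp.sum, AddMonoidAlgebra.coeff_sum,
      Finset.sum_apply', AddMonoidAlgebra.coeff_smul, Finsupp.smul_apply, smul_eq_mul] at h1
    have h2 : ∑ n : G, A m' n * (Matrix.of fun n m : G => a m n) n m =
        ∑ n ∈ G, a m n * (C.element c n).coeff m' := by
      rw [← Finset.sum_coe_sort G]
      exact Finset.sum_congr rfl fun n _ => mul_comm _ _
    rw [h2]
    have h3 : ∑ n ∈ G, a m n * (C.element c n).coeff m' =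
        ∑ n ∈ (a m).support, a m n * (C.element c n).coeff m' := by
      rw [← Finset.sum_filter_of_ne (s := G) (p := fun n => n ∈ (a m).support),
        ← Finset.sum_filter_of_ne (s := (a m).support) (p := fun n => n ∈ G)]
      · refine Finset.sum_congr ?_ fun _ _ => rfl
        ext n
        simp only [Finset.mem_filter]
        tauto
      · intro n hn hne
        have hnQ := ha m m.2 n hn
        have := isHomogeneous_element c hnQ m' (right_ne_zero_of_mul hne)
        exact (hG n).2 ⟨hnQ, this.2 ▸ ((hG m').1 m'.2).2⟩
      · intro n _ hne
        exact Finsupp.mem_support_iff.2 (left_ne_zero_of_mul hne)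
    rw [h3, h1, Finsupp.single_apply, Matrix.one_apply]
    simp only [eq_comm (a := (m : N)), Subtype.ext_iff]
  have hinv' := mul_eq_one_comm.1 hinv
  rw [linearIndepOn_finset_iff]
  intro x hx n hn
  have hAx : A.mulVec (fun n : G => x n) = 0 := by
    ext m
    have h1 := congrArg (fun y => AddMonoidAlgebra.coeff y (m : N)) hx
    simp only [AddMonoidAlgebra.coeff_sum, Finset.sum_apply', AddMonoidAlgebra.coeff_smul,
      Finsupp.smul_apply, smul_eq_mul, AddMonoidAlgebra.coeff_zero, Finsupp.zero_apply] at h1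
    rw [← Finset.sum_coe_sort G] at h1
    rw [Matrix.mulVec, dotProduct, Pi.zero_apply, ← h1]
    exact Finset.sum_congr rfl fun n _ => mul_comm _ _
  have := congrArg (fun y => (Matrix.of fun n m : G => a m n).mulVec y) hAx
  simp only [Matrix.mulVec_mulVec, hinv', Matrix.one_mulVec, Matrix.mulVec_zero] at this
  exact congrFun this ⟨n, hn⟩

end Determinant

end ShiftedCone

/-! ### The free presentation of a shifted semigroup module -/

namespace ShiftedCone

variable {N E : Type*} [AddCommGroup N] [AddCommGroup E] [Module ℝ E] {d : ℕ}
  {C : ShiftedCone N E d}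

section Presentation

variable {r : ℕ} (f : Module.Basis (Fin r) ℂ (N →+ ℂ))

variable (C) in
/-- The element `∑ p, ⟨g, e p⟩ c p x ^ (e p)` of the complex group ring for an additive map `g`. -/
def linElement (c : Fin d → ℂ) : (N →+ ℂ) →ₗ[ℂ] AddMonoidAlgebra ℂ N where
  toFun g := ∑ p, AddMonoidAlgebra.single (C.e p) (g (C.e p) * c p)
  map_add' g g' := by
    rw [← Finset.sum_add_distrib]
    exact Finset.sum_congr rfl fun p _ => by
      rw [AddMonoidHom.add_apply, add_mul, AddMonoidAlgebra.single_add]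
  map_smul' z g := by
    rw [Finset.smul_sum]
    exact Finset.sum_congr rfl fun p _ => by
      simp [mul_assoc]

theorem linElement_apply (c : Fin d → ℂ) (g : N →+ ℂ) :
    C.linElement c g = ∑ p, AddMonoidAlgebra.single (C.e p) (g (C.e p) * c p) := rfl

/-- The coordinate functions of a frame on the lattice. -/
def coordHom (σ : Frame C.vec) (l : Fin d) : N →+ ℂ where
  toFun n := ((σ.coord (C.toE n) l : ℝ) : ℂ)
  map_zero' := by simp
  map_add' := by simp

theorem coordHom_apply (σ : Frame C.vec) (l : Fin d) (n : N) :
    coordHom σ l n = ((σ.coord (C.toE n) l : ℝ) : ℂ) := rfl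

theorem linElement_coordHom (c : Fin d → ℂ) (σ : Frame C.vec) (l : Fin d) :
    C.linElement c (coordHom σ l) = coordElement σ c l := by
  simp [linElement_apply, coordElement, coordHom_apply]

/-- An additive map on the lattice is the combination of the coordinate functions of a frame with
its values on the frame. -/
theorem sum_smul_coordHom (σ : Frame C.vec) (g : N →+ ℂ) :
    ∑ l : σ.1, g (C.e l) • coordHom σ l = g := by
  obtain ⟨G, hG⟩ := C.exists_extend g
  ext n
  rw [AddMonoidHom.finsetSum_apply]
  simp only [AddMonoidHom.smul_apply, coordHom_apply]
  rw [Finset.sum_coe_sort σ.1 (fun l => g (C.e l) • ((σ.coord (C.toE n) l : ℝ) : ℂ)),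
    Finset.sum_subset (Finset.subset_univ σ.1) fun l _ hl => by
      rw [σ.coord_of_notMem _ hl, Complex.ofReal_zero, smul_zero]]
  conv_rhs => rw [← hG, ← σ.sum_coord (C.toE n), map_sum]
  refine Finset.sum_congr rfl fun l _ => ?_
  rw [map_smul, hG, Complex.real_smul, smul_eq_mul, mul_comm]

variable (C) in
/-- Evaluation of polynomials at the linear elements of a basis of the additive maps. -/
def evalLin (c : Fin d → ℂ) : MvPolynomial (Fin r) ℂ →ₐ[ℂ] AddMonoidAlgebra ℂ N :=
  MvPolynomial.aeval fun j => C.linElement c (f j)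

/-- The linear form in the basis `f` that represents a coordinate function of a frame. -/
def coordForm (σ : Frame C.vec) (l : Fin d) : MvPolynomial (Fin r) ℂ :=
  ∑ j, MvPolynomial.C (f.repr (coordHom σ l) j) * MvPolynomial.X j

theorem evalLin_coordForm (c : Fin d → ℂ) (σ : Frame C.vec) (l : Fin d) :
    C.evalLin f c (coordForm f σ l) = coordElement σ c l := by
  rw [← linElement_coordHom, ← f.sum_repr (coordHom σ l), map_sum]
  simp only [coordForm, evalLin, map_sum, map_mul, MvPolynomial.aeval_X,
    map_smul, MvPolynomial.algHom_C, Algebra.smul_def]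

/-- The linear change of coordinates between the basis `f` and the coordinate functions of a
frame. -/
def coordEquiv (σ : Frame C.vec) : MvPolynomial σ.1 ℂ ≃ₐ[ℂ] MvPolynomial (Fin r) ℂ :=
  AlgEquiv.ofAlgHom (MvPolynomial.aeval fun l : σ.1 => coordForm f σ l)
    (MvPolynomial.aeval fun j => ∑ l : σ.1, MvPolynomial.C (f j (C.e l)) * MvPolynomial.X l)
    (by
      refine MvPolynomial.algHom_ext fun j => ?_
      simp only [AlgHom.comp_apply, MvPolynomial.aeval_X, map_sum, map_mul, MvPolynomial.algHom_C,
        AlgHom.id_apply, coordForm, Finset.mul_sum]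
      rw [Finset.sum_comm]
      have h : ∀ i, ∑ l : σ.1, f j (C.e l) * f.repr (coordHom σ l) i =
          (Finsupp.single j 1 : Fin r →₀ ℂ) i := fun i => by
        have := congrArg (fun g => f.repr g i) (sum_smul_coordHom σ (f j))
        simpa [Finsupp.finsetSum_apply] using this
      simp only [MvPolynomial.algebraMap_eq, ← mul_assoc, ← map_mul, ← Finset.sum_mul, ← map_sum,
        h]
      rw [Finset.sum_eq_single j] <;> simp +contextual [eq_comm])
    (by
      refine MvPolynomial.algHom_ext fun l => ?_
      simp only [AlgHom.comp_apply, MvPolynomial.aeval_X, map_sum, map_mul, MvPolynomial.algHom_C,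
        AlgHom.id_apply, coordForm, Finset.mul_sum]
      rw [Finset.sum_comm]
      have h : ∀ k : σ.1, ∑ i, f.repr (coordHom σ l) i * f i (C.e k) =
          (Pi.single (k : Fin d) 1 : Fin d → ℂ) l := fun k => by
        have := DFunLike.congr_fun (f.sum_repr (coordHom σ l)) (C.e k)
        rw [AddMonoidHom.finsetSum_apply] at this
        simp only [AddMonoidHom.smul_apply, smul_eq_mul] at this
        rw [this, coordHom_apply, σ.coord_self k.2]
        by_cases hkl : l = k
        · simp [hkl]
        · have : (l : Fin d) ≠ k := fun h => hkl (Subtype.ext h)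
          simp [this]
      simp only [MvPolynomial.algebraMap_eq, ← mul_assoc, ← map_mul, ← Finset.sum_mul, ← map_sum,
        h]
      rw [Finset.sum_eq_single l]
      · simp
      · intro k _ hk
        have : (l : Fin d) ≠ k := fun h => hk (Subtype.ext h.symm)
        simp [this]
      · simp)

theorem evalLin_coordEquiv (c : Fin d → ℂ) (σ : Frame C.vec) (k : σ.1 →₀ ℕ) :
    C.evalLin f c (coordEquiv f σ (MvPolynomial.monomial k 1)) =
      coordMonomial σ c (k.mapDomain Subtype.val) := by
  have h1 : coordEquiv f σ (MvPolynomial.monomial k 1) = ∏ l : σ.1, coordForm f σ l ^ k l := by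
    change (MvPolynomial.aeval fun l : σ.1 => coordForm f σ l) _ = _
    rw [MvPolynomial.aeval_monomial, map_one, one_mul, Finsupp.prod_fintype]
    simp
  rw [h1, map_prod, coordMonomial]
  simp only [map_pow, evalLin_coordForm]
  rw [← Finset.prod_subset (Finset.subset_univ σ.1), ← Finset.prod_coe_sort σ.1]
  · refine Finset.prod_congr rfl fun l _ => ?_
    rw [Finsupp.mapDomain_apply Subtype.val_injective]
  · intro l _ hl
    rw [Finsupp.mapDomain_of_notMem_range, pow_zero]
    simpa using hl

variable (C) in
/-- The candidate for a free presentation of the shifted semigroup module over the polynomial ring: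
the basis vectors are sent to the monomials of the box points. -/
def presentation (c : Fin d → ℂ) :
    (C.box →₀ MvPolynomial (Fin r) ℂ) →ₗ[ℂ] AddMonoidAlgebra ℂ N :=
  Finsupp.lsum ℂ fun b => LinearMap.mulRight ℂ (AddMonoidAlgebra.single (b : N) 1) ∘ₗ
    (C.evalLin f c).toLinearMap

theorem presentation_single (c : Fin d → ℂ) (b : C.box) (x : MvPolynomial (Fin r) ℂ) :
    C.presentation f c (Finsupp.single b x) =
      C.evalLin f c x * AddMonoidAlgebra.single (b : N) 1 := by
  simp [presentation]

theorem presentation_smul (c : Fin d → ℂ) (a : MvPolynomial (Fin r) ℂ)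
    (x : C.box →₀ MvPolynomial (Fin r) ℂ) :
    C.presentation f c (a • x) = C.evalLin f c a * C.presentation f c x := by
  induction x using Finsupp.induction_linear with
  | zero => simp
  | add x y hx hy => rw [smul_add, map_add, hx, hy, map_add, mul_add]
  | single b x =>
    rw [Finsupp.smul_single, presentation_single, presentation_single, smul_eq_mul, map_mul,
      mul_assoc]

/-- The basis over the complex numbers of the source of the presentation that is adapted to the
cells of the box points. -/
def cellBasis : Module.Basis (Σ b : C.box, (C.cell b).1 →₀ ℕ) ℂ
    (C.box →₀ MvPolynomial (Fin r) ℂ) :=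
  Finsupp.basis fun b => (MvPolynomial.basisMonomials (C.cell b).1 ℂ).map
    (coordEquiv f (C.cell b)).toLinearEquiv

variable (C) in
/-- The lattice point with given base point and exponents. -/
def cellPoint (i : Σ b : C.box, (C.cell b).1 →₀ ℕ) : N :=
  i.1 + ∑ l, i.2.mapDomain Subtype.val l • C.e l

theorem mapDomain_val_eq_zero {σ : Frame C.vec} (k : σ.1 →₀ ℕ) :
    ∀ l ∉ σ, k.mapDomain Subtype.val l = 0 := fun l hl => by
  rw [Finsupp.mapDomain_of_notMem_range]
  rintro ⟨i, rfl⟩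
  exact hl i.2

theorem cellPoint_mem (i : Σ b : C.box, (C.cell b).1 →₀ ℕ) : C.cellPoint i ∈ C.points :=
  add_sum_mem_points i.1.2.1 _

theorem cellPoint_injective : Function.Injective C.cellPoint := by
  rintro ⟨b, k⟩ ⟨b', k'⟩ h
  have hb := base_add_sum_eq b.2 (mapDomain_val_eq_zero k)
  have hb' := base_add_sum_eq b'.2 (mapDomain_val_eq_zero k')
  have hk := exps_add_sum b.2 (mapDomain_val_eq_zero k)
  have hk' := exps_add_sum b'.2 (mapDomain_val_eq_zero k')
  simp only [cellPoint] at h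
  rw [h] at hb hk
  obtain rfl : b = b' := Subtype.ext (hb.symm.trans hb')
  have : k = k' := Finsupp.mapDomain_injective Subtype.val_injective
    (DFunLike.coe_injective (hk.symm.trans hk'))
  rw [this]

theorem exists_cellPoint_eq {n : N} (hn : n ∈ C.points) : ∃ i, C.cellPoint i = n := by
  refine ⟨⟨⟨C.base n, base_mem_box hn⟩,
    Finsupp.equivFunOnFinite.symm fun l => C.exps n l⟩, ?_⟩
  conv_rhs => rw [← base_add_sum (C := C) n]
  rw [cellPoint]
  congr 1
  refine Finset.sum_congr rfl fun l _ => ?_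
  by_cases hl : l ∈ C.cell (C.base n)
  · congr 1
    exact Finsupp.mapDomain_apply (Subtype.val_injective) _ (⟨l, hl⟩ : (C.cell (C.base n)).1)
  · rw [mapDomain_val_eq_zero _ l hl, exps_of_notMem (cell_base hn ▸ hl)]

theorem presentation_cellBasis (c : Fin d → ℂ) (i : Σ b : C.box, (C.cell b).1 →₀ ℕ) :
    C.presentation f c (cellBasis f i) = C.element c (C.cellPoint i) := by
  obtain ⟨b, k⟩ := i
  have h1 : cellBasis f ⟨b, k⟩ =
      Finsupp.single b (coordEquiv f (C.cell b) (MvPolynomial.monomial k 1)) := by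
    simp [cellBasis]
  rw [h1, presentation_single, evalLin_coordEquiv, element, cellPoint,
    base_add_sum_eq b.2 (mapDomain_val_eq_zero k), cell_add_sum b.2.1 (mapDomain_val_eq_zero k),
    exps_add_sum b.2 (mapDomain_val_eq_zero k), mul_comm]

theorem coeff_presentation_ne_zero (c : Fin d → ℂ) (x : C.box →₀ MvPolynomial (Fin r) ℂ) {m : N}
    (hm : (C.presentation f c x).coeff m ≠ 0) : m ∈ C.points := by
  rw [← (cellBasis f).linearCombination_repr x, Finsupp.linearCombination_apply, Finsupp.sum,
    map_sum, AddMonoidAlgebra.coeff_sum, Finset.sum_apply'] at hm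
  obtain ⟨i, -, hi⟩ := Finset.exists_ne_zero_of_sum_ne_zero hm
  rw [map_smul, presentation_cellBasis, AddMonoidAlgebra.coeff_smul, Finsupp.smul_apply] at hi
  exact (isHomogeneous_element c (cellPoint_mem i) m (right_ne_zero_of_smul hi)).1

theorem image_element_subset (c : Fin d → ℂ) :
    C.element c '' C.points ⊆ Set.range (C.presentation f c) := by
  rintro _ ⟨n, hn, rfl⟩
  obtain ⟨i, rfl⟩ := exists_cellPoint_eq hn
  exact ⟨_, presentation_cellBasis f c i⟩

/-- The presentation is an isomorphism for generic coefficients. Surjectivity follows once the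
image contains the finitely many products of a box monomial with a generator, because then the
image is stable under all generators. -/
theorem exists_polynomial_presentation (C : ShiftedCone N E d) : ∃ P : MvPolynomial (Fin d) ℂ,
    P ≠ 0 ∧ ∀ c : Fin d → ℂ, MvPolynomial.eval c P ≠ 0 →
      Function.Injective (C.presentation f c) ∧ ∀ x : AddMonoidAlgebra ℂ N,
        x ∈ Set.range (C.presentation f c) ↔ ∀ m, x.coeff m ≠ 0 → m ∈ C.points := by
  classical
  -- the box monomials and their products with a generator have degree at most `D + 1`
  obtain ⟨D, hD⟩ := (C.box_finite.image C.deg).bddAbove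
  set G := (C.finite_points_le (D + 1)).toFinset with hGdef
  have hG : ∀ n, n ∈ G ↔ n ∈ C.points ∧ C.deg n ≤ D + 1 := fun n => by simp [hGdef]
  refine ⟨C.detPolynomial G, detPolynomial_ne_zero fun n hn => ((hG n).1 hn).1, fun c hc => ?_⟩
  set W := LinearMap.range (C.presentation f c) with hW
  have hsmall : ∀ m ∈ G, AddMonoidAlgebra.single m 1 ∈ W := fun m hm =>
    Submodule.span_le.2 (image_element_subset f c) (single_mem_span_element hG hc hm)
  have hstep : ∀ l, ∀ x ∈ W, x * AddMonoidAlgebra.single (C.e l) 1 ∈ W := by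
    rintro l _ ⟨x, rfl⟩
    induction x using Finsupp.induction_linear with
    | zero => simp
    | add x y hx hy => rw [map_add, add_mul]; exact W.add_mem hx hy
    | single b x =>
      rw [presentation_single, mul_assoc, AddMonoidAlgebra.single_mul_single, one_mul]
      obtain ⟨y, hy⟩ := hsmall (b + C.e l) ((hG _).2 ⟨add_mem_points b.2.1 l, by
        rw [map_add, C.deg_e]
        have := hD ⟨b, b.2, rfl⟩
        omega⟩)
      exact ⟨x • y, by rw [presentation_smul, hy]⟩
  have hsingle : ∀ n ∈ C.points, AddMonoidAlgebra.single n 1 ∈ W := by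
    intro n hn
    refine base_add_sum (C := C) n ▸ cell_induction (base_mem hn)
      (motive := fun n _ => AddMonoidAlgebra.single n 1 ∈ W) ?_ ?_ fun l hl =>
        exps_of_notMem (cell_base hn ▸ hl)
    · refine hsmall _ ((hG _).2 ⟨base_mem hn, ?_⟩)
      have := hD ⟨_, base_mem_box hn, rfl⟩
      omega
    · intro n _ l _ _ _ h
      simpa [AddMonoidAlgebra.single_mul_single] using hstep l _ h
  have hmem : ∀ x : AddMonoidAlgebra ℂ N,
      x ∈ Set.range (C.presentation f c) ↔ ∀ m, x.coeff m ≠ 0 → m ∈ C.points := by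
    intro x
    refine ⟨?_, fun h => ?_⟩
    · rintro ⟨y, rfl⟩ m hm
      exact coeff_presentation_ne_zero f c y hm
    · change x ∈ W
      rw [← AddMonoidAlgebra.sum_coeff_single x]
      refine Submodule.sum_mem _ fun m hm => ?_
      have := W.smul_mem (x.coeff m) (hsingle m (h m (Finsupp.mem_support_iff.1 hm)))
      simpa using this
  refine ⟨?_, hmem⟩
  have hWspan : W ≤ Submodule.span ℂ (C.element c '' C.points) := by
    rintro _ ⟨x, rfl⟩
    rw [← (cellBasis f).linearCombination_repr x, Finsupp.linearCombination_apply, Finsupp.sum,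
      map_sum]
    refine Submodule.sum_mem _ fun i _ => ?_
    rw [map_smul, presentation_cellBasis]
    exact Submodule.smul_mem _ _ (Submodule.subset_span ⟨_, cellPoint_mem i, rfl⟩)
  have hli := linearIndepOn_element fun m hm => hWspan (hsingle m hm)
  have hli' : LinearIndependent ℂ fun i => C.presentation f c (cellBasis f i) := by
    simp only [presentation_cellBasis]
    exact LinearIndependent.comp hli (fun i => (⟨C.cellPoint i, cellPoint_mem i⟩ : C.points))
      fun i j h => cellPoint_injective (Subtype.ext_iff.1 h)
  have hcomp : C.presentation f c = Finsupp.linearCombination ℂ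
      (fun i => C.presentation f c (cellBasis f i)) ∘ₗ (cellBasis f).repr.toLinearMap :=
    (cellBasis f).ext fun i => by simp
  rw [hcomp]
  rw [LinearMap.coe_comp]
  exact Function.Injective.comp (g := Finsupp.linearCombination ℂ _) hli'
    (cellBasis f).repr.injective

end Presentation

end ShiftedCone

/-! ### Regular sequences and Cohen–Macaulay modules from freeness -/

section CommutativeAlgebra

open RingTheory.Sequence

/-- The variables of a polynomial ring over a field form a weakly regular sequence. -/
theorem isWeaklyRegular_X (k : Type*) [Field k] (r : ℕ) :
    IsWeaklyRegular (MvPolynomial (Fin r) k)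
      (List.ofFn fun j : Fin r => (MvPolynomial.X j : MvPolynomial (Fin r) k)) := by
  refine ⟨fun i hi => ?_⟩
  rw [List.length_ofFn] at hi
  rw [isSMulRegular_quotient_iff_mem_of_smul_mem]
  have hspan : (Ideal.ofList ((List.ofFn fun j : Fin r =>
      (MvPolynomial.X j : MvPolynomial (Fin r) k)).take i) • ⊤ : Ideal (MvPolynomial (Fin r) k)) =
      Ideal.span (MvPolynomial.X '' {j : Fin r | (j : ℕ) < i}) := by
    rw [smul_eq_mul, Ideal.mul_top, Ideal.ofList]
    congr 1
    ext x
    simp only [Set.mem_ofPred_eq, List.mem_take_iff_getElem, List.getElem_ofFn, List.length_ofFn,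
      Set.mem_image]
    constructor
    · rintro ⟨j, hj, rfl⟩
      exact ⟨⟨j, by omega⟩, by simp; omega, rfl⟩
    · rintro ⟨j, hj, rfl⟩
      exact ⟨j, by omega, rfl⟩
  rw [hspan]
  intro x hx
  rw [MvPolynomial.mem_ideal_span_X_image] at hx ⊢
  intro m hm
  rw [List.getElem_ofFn, smul_eq_mul] at hx
  obtain ⟨j, hj, hmj⟩ := hx (Finsupp.single ⟨i, hi⟩ 1 + m) (by
    rw [MvPolynomial.mem_support_iff, MvPolynomial.coeff_X_mul]
    exact MvPolynomial.mem_support_iff.1 hm)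
  refine ⟨j, hj, ?_⟩
  have hne : j ≠ ⟨i, hi⟩ := by
    rintro rfl
    exact lt_irrefl i hj
  rwa [Finsupp.add_apply, Finsupp.single_eq_of_ne hne, zero_add] at hmj

/-- Translations of affine space preserve regularity of the coordinate sequence. -/
theorem isWeaklyRegular_X_sub_C (k : Type*) [Field k] {r : ℕ} (a : Fin r → k) :
    IsWeaklyRegular (MvPolynomial (Fin r) k)
      (List.ofFn fun j : Fin r => (MvPolynomial.X j - MvPolynomial.C (a j) :
        MvPolynomial (Fin r) k)) := by
  let τ : MvPolynomial (Fin r) k ≃ₐ[k] MvPolynomial (Fin r) k := AlgEquiv.ofAlgHom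
    (MvPolynomial.aeval fun j => MvPolynomial.X j - MvPolynomial.C (a j))
    (MvPolynomial.aeval fun j => MvPolynomial.X j + MvPolynomial.C (a j))
    (MvPolynomial.algHom_ext fun j => by simp [MvPolynomial.algHom_C])
    (MvPolynomial.algHom_ext fun j => by simp [MvPolynomial.algHom_C])
  have hτ : ∀ j, τ (MvPolynomial.X j) = MvPolynomial.X j - MvPolynomial.C (a j) := fun j =>
    MvPolynomial.aeval_X _ j
  refine ((τ : _ ≃+* _).toAddEquiv.isWeaklyRegular_congr ?_).1 (isWeaklyRegular_X k r)
  rw [List.forall₂_iff_get]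
  refine ⟨by simp, fun i h₁ h₂ x => ?_⟩
  simp only [List.get_eq_getElem, List.getElem_ofFn, smul_eq_mul, ← hτ]
  exact map_mul τ _ _

theorem isWeaklyRegular_of_flat {A M : Type*} [CommRing A] [AddCommGroup M] [Module A M]
    [Module.Flat A M] {rs : List A} (h : IsWeaklyRegular A rs) : IsWeaklyRegular M rs :=
  ((TensorProduct.rid A M).isWeaklyRegular_congr rs).1 h.isWeaklyRegular_lTensor

/-- A proper ideal does not generate a nonzero free module. -/
theorem ofList_smul_top_ne_top {A B : Type*} [CommRing A] [Nonempty B] {rs : List A}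
    (h : Ideal.ofList rs ≠ ⊤) : (⊤ : Submodule A (B →₀ A)) ≠ Ideal.ofList rs • ⊤ := by
  intro htop
  obtain ⟨b⟩ := ‹Nonempty B›
  refine h ((Ideal.eq_top_iff_one _).2 ?_)
  have h1 : Finsupp.single b (1 : A) ∈ (Ideal.ofList rs • ⊤ : Submodule A (B →₀ A)) :=
    htop ▸ Submodule.mem_top
  have h2 := Submodule.mem_map_of_mem (f := Finsupp.lapply (R := A) b) h1
  rw [Submodule.map_smul''] at h2
  have h3 := smul_mono_right (Ideal.ofList rs) (le_top (a := Submodule.map _ _)) h2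
  simpa using h3

section Transfer

variable {k : Type*} [Field k] {r : ℕ} {R M B : Type*} [CommRing R] [AddCommGroup M] [Module R M]
  (φ : MvPolynomial (Fin r) k →+* R) (Φ : (B →₀ MvPolynomial (Fin r) k) ≃+ M)
  (hΦ : ∀ a x, Φ (a • x) = φ a • Φ x)

include hΦ in
/-- On a module that is free over a polynomial ring all translates of the sequence of variables
are weakly regular. -/
theorem isWeaklyRegular_of_free (a : Fin r → k) : IsWeaklyRegular M
    (List.ofFn fun j => φ (MvPolynomial.X j - MvPolynomial.C (a j))) := by
  refine (Φ.isWeaklyRegular_congr ?_).1 (isWeaklyRegular_of_flat (isWeaklyRegular_X_sub_C k a))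
  rw [List.forall₂_iff_get]
  refine ⟨by simp, fun i h₁ h₂ x => ?_⟩
  simp only [List.get_eq_getElem, List.getElem_ofFn, hΦ]

include hΦ in
theorem isRegular_of_free [Nonempty B] :
    IsRegular M (List.ofFn fun j => φ (MvPolynomial.X j)) := by
  have hreg : IsRegular (B →₀ MvPolynomial (Fin r) k)
      (List.ofFn fun j : Fin r => (MvPolynomial.X j : MvPolynomial (Fin r) k)) := by
    refine ⟨isWeaklyRegular_of_flat (isWeaklyRegular_X k r), ofList_smul_top_ne_top fun h => ?_⟩
    have hle : Ideal.ofList (List.ofFn fun j : Fin r =>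
        (MvPolynomial.X j : MvPolynomial (Fin r) k)) ≤
        RingHom.ker (MvPolynomial.aeval (R := k) (0 : Fin r → k)).toRingHom := by
      refine Ideal.span_le.2 fun x hx => ?_
      obtain ⟨j, rfl⟩ := List.mem_ofFn.1 hx
      simp [RingHom.mem_ker]
    rw [h, top_le_iff] at hle
    exact RingHom.ker_ne_top _ hle
  refine (Φ.isRegular_congr ?_).1 hreg
  rw [List.forall₂_iff_get]
  refine ⟨by simp, fun i h₁ h₂ x => ?_⟩
  simp only [List.get_eq_getElem, List.getElem_ofFn, hΦ]

end Transfer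

theorem ringKrullDim_le_of_finite {A R : Type*} [CommRing A] [CommRing R] (φ : A →+* R)
    (hφ : φ.Finite) : ringKrullDim R ≤ ringKrullDim A := by
  algebraize [φ]
  have : Algebra.IsIntegral A R := inferInstance
  refine Order.krullDim_le_of_strictMono (PrimeSpectrum.comap (algebraMap A R)) fun p q h => ?_
  exact Ideal.IsIntegral.comap_lt_comap (R := A) (I := p.asIdeal) (J := q.asIdeal) h

theorem length_le_supportDim {A M : Type*} [CommRing A] [IsLocalRing A] [IsNoetherianRing A]
    [AddCommGroup M] [Module A M] [Module.Finite A M] {rs : List A} (h : IsRegular M rs) :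
    (rs.length : WithBot ℕ∞) ≤ Module.supportDim A M := by
  rw [← Module.supportDim_add_length_eq_supportDim_of_isRegular rs h]
  have := h.quot_ofList_smul_nontrivial
  have h0 : (0 : WithBot ℕ∞) ≤ Module.supportDim A (M ⧸ (Ideal.ofList rs • ⊤ : Submodule A M)) := by
    have hne := Module.supportDim_ne_bot_of_nontrivial A
      (M ⧸ (Ideal.ofList rs • ⊤ : Submodule A M))
    obtain ⟨n, hn⟩ := WithBot.ne_bot_iff_exists.1 hne
    rw [← hn]
    exact WithBot.coe_le_coe.2 bot_le
  simpa using add_le_add_left h0 (rs.length : WithBot ℕ∞)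

/-- A finite module over a finite extension of a polynomial ring is Cohen-Macaulay if it is free
over the polynomial ring: by the Nullstellensatz each maximal ideal contains a translate of the
sequence of variables. -/
theorem isCohenMacaulayModule_of_free {k : Type*} [Field k] [IsAlgClosed k] {r : ℕ}
    {R M B : Type*} [CommRing R] [Algebra k R] [AddCommGroup M] [Module R M] [Module.Finite R M]
    (φ : MvPolynomial (Fin r) k →ₐ[k] R) (hφ : φ.toRingHom.Finite)
    (Φ : (B →₀ MvPolynomial (Fin r) k) ≃+ M) (hΦ : ∀ a x, Φ (a • x) = φ a • Φ x) :
    IsCohenMacaulayModule R M := by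
  have hdim : ringKrullDim R ≤ r := by
    refine (ringKrullDim_le_of_finite _ hφ).trans ?_
    rw [MvPolynomial.ringKrullDim_of_isNoetherianRing]
    simp
  have hnoeth : IsNoetherianRing R := by
    have hφ' : φ.toRingHom.Finite := hφ
    algebraize [φ.toRingHom]
    exact IsNoetherianRing.of_finite (MvPolynomial (Fin r) k) R
  have hft : Algebra.FiniteType k R := by
    have h1 : φ.toRingHom.FiniteType := RingHom.FiniteType.of_finite hφ
    have h2 : (algebraMap k (MvPolynomial (Fin r) k)).FiniteType := by
      rw [RingHom.finiteType_algebraMap]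
      infer_instance
    have h3 := h1.comp h2
    rw [AlgHom.toRingHom_eq_coe, AlgHom.comp_algebraMap] at h3
    exact RingHom.finiteType_algebraMap.1 h3
  refine ⟨hnoeth, inferInstance, fun 𝔪 _ hnt => ?_⟩
  have hpoint : ∀ x : R, ∃ a : k, x - algebraMap k R a ∈ 𝔪 := by
    intro x
    let := Ideal.Quotient.field 𝔪
    have : Algebra.FiniteType k (R ⧸ 𝔪) := inferInstance
    have := finite_of_finite_type_of_isJacobsonRing k (R ⧸ 𝔪)
    obtain ⟨a, ha⟩ := (IsAlgClosed.algebraMap_bijective_of_isIntegral (k := k)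
      (K := R ⧸ 𝔪)).2 (Ideal.Quotient.mk 𝔪 x)
    refine ⟨a, ?_⟩
    rw [← Ideal.Quotient.eq_zero_iff_mem, map_sub, ← ha]
    exact sub_self _
  choose a ha using fun j => hpoint (φ (MvPolynomial.X j))
  set rs := List.ofFn fun j => φ (MvPolynomial.X j - MvPolynomial.C (a j)) with hrs
  have hweak : IsWeaklyRegular M rs := isWeaklyRegular_of_free φ.toRingHom Φ hΦ a
  have hmem : ∀ x ∈ rs, x ∈ 𝔪 := by
    intro x hx
    obtain ⟨j, rfl⟩ := List.mem_ofFn.1 hx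
    simpa [MvPolynomial.algHom_C] using ha j
  have hloc := hweak.isRegular_of_isLocalizedModule_of_mem (Localization.AtPrime 𝔪) 𝔪
    (LocalizedModule.mkLinearMap 𝔪.primeCompl M) hmem
  have hdimloc : Module.supportDim (Localization.AtPrime 𝔪)
      (LocalizedModule 𝔪.primeCompl M) ≤ r := by
    refine (Module.supportDim_le_ringKrullDim _ _).trans (le_trans ?_ hdim)
    rw [IsLocalization.AtPrime.ringKrullDim_eq_height 𝔪]
    exact Ideal.height_le_ringKrullDim_of_ne_top Ideal.IsPrime.ne_top'
  have hlen : (rs.map (algebraMap R (Localization.AtPrime 𝔪))).length = r := by simp [hrs]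
  -- the translated variables bound the depth from below, the dimension of `R` from above
  have hdepth : depth (Localization.AtPrime 𝔪) (LocalizedModule 𝔪.primeCompl M) = r := by
    refine le_antisymm (iSup₂_le fun xs hxs => ?_) ?_
    · have := (length_le_supportDim hxs.1).trans hdimloc
      exact_mod_cast this
    · rw [← hlen]
      refine le_iSup₂_of_le (rs.map (algebraMap R (Localization.AtPrime 𝔪))) ⟨hloc, ?_⟩ le_rfl
      intro x hx
      obtain ⟨y, hy, rfl⟩ := List.mem_map.1 hx
      exact (IsLocalization.AtPrime.to_map_mem_maximal_iff _ 𝔪 y).2 (hmem y hy)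
  rw [hdepth]
  refine le_antisymm ?_ hdimloc
  have := length_le_supportDim hloc
  rw [hlen] at this
  exact_mod_cast this

end CommutativeAlgebra

/-! ### Ray generators of rational cones -/

section Rays

theorem mem_hull_singleton {E : Type*} [AddCommGroup E] [Module ℝ E] {v x : E} :
    x ∈ PointedCone.hull ℝ {v} ↔ ∃ c : ℝ, 0 ≤ c ∧ x = c • v := by
  rw [Submodule.mem_span_singleton]
  exact ⟨fun ⟨c, hc⟩ => ⟨c, c.2, hc.symm⟩, fun ⟨c, h0, hc⟩ => ⟨⟨c, h0⟩, hc.symm⟩⟩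

theorem mem_hull_range {E : Type*} [AddCommGroup E] [Module ℝ E] {d : ℕ} {v : Fin d → E} {x : E} :
    x ∈ PointedCone.hull ℝ (Set.range v) ↔ ∃ a : Fin d → ℝ, (∀ l, 0 ≤ a l) ∧ ∑ l, a l • v l = x := by
  rw [Submodule.mem_span_range_iff_exists_fun]
  exact ⟨fun ⟨c, hc⟩ => ⟨fun l => c l, fun l => (c l).2, hc⟩,
    fun ⟨a, h0, ha⟩ => ⟨fun l => ⟨a l, h0 l⟩, ha⟩⟩

variable {N : Type*} [AddCommGroup N]

theorem exists_extend_toReal {V : Type*} [AddCommGroup V] [Module ℝ V] (g : N →+ V) :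
    ∃ G : ℝ ⊗[ℤ] N →ₗ[ℝ] V, ∀ n, G (toReal n) = g n :=
  ⟨(TensorProduct.isBaseChange ℤ N ℝ).lift g.toIntLinearMap, fun n =>
    (TensorProduct.isBaseChange ℤ N ℝ).lift_eq g.toIntLinearMap n⟩

variable [Module.Free ℤ N]

theorem toReal_injective : Function.Injective (toReal : N → ℝ ⊗[ℤ] N) := by
  intro x y h
  let b := Module.Free.chooseBasis ℤ N
  refine b.repr.injective (Finsupp.ext fun i => ?_)
  have h1 := congrArg (fun v => (b.baseChange ℝ).repr v i) h
  simpa [toReal] using h1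

/-- The lattice points of a rational ray are the natural multiples of a single lattice point. -/
theorem exists_generator {n : N} (hn : n ≠ 0) : ∃ n₀ : N, n₀ ≠ 0 ∧
    PointedCone.hull ℝ {toReal n₀} = PointedCone.hull ℝ {toReal n} ∧
      ∀ x : N, toReal x ∈ PointedCone.hull ℝ {toReal n} → ∃ k : ℕ, x = k • n₀ := by
  classical
  obtain ⟨f, hf⟩ : ∃ f : N →+ ℤ, 0 < f n := by
    let b := Module.Free.chooseBasis ℤ N
    obtain ⟨i, hi⟩ : ∃ i, b.repr n i ≠ 0 := by
      by_contra! H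
      exact hn (b.repr.injective (Finsupp.ext fun i => by simpa using H i))
    rcases lt_or_gt_of_ne hi with h | h
    · exact ⟨-(b.coord i).toAddMonoidHom, by simpa using h⟩
    · exact ⟨(b.coord i).toAddMonoidHom, by simpa using h⟩
  obtain ⟨F, hF⟩ := exists_extend_toReal ((Int.castAddHom ℝ).comp f)
  have hF : ∀ x, F (toReal x) = f x := hF
  have hfR : (0 : ℝ) < f n := by exact_mod_cast hf
  have hc : ∀ (x : N) (c : ℝ), toReal x = c • toReal n → (f x : ℝ) = c * f n := by
    intro x c h
    rw [← hF, h, map_smul, hF, smul_eq_mul]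
  have hex : ∃ k : ℕ, 0 < k ∧ ∃ x : N, toReal x ∈ PointedCone.hull ℝ {toReal n} ∧ f x = k :=
    ⟨(f n).toNat, by omega, n, PointedCone.subset_hull rfl, by omega⟩
  -- the lattice point of the ray with the least positive value of `f`
  obtain ⟨hk, n₀, hn₀, hfn₀⟩ := Nat.find_spec hex
  have hmin : ∀ y : N, toReal y ∈ PointedCone.hull ℝ {toReal n} → 0 < f y →
      (Nat.find hex : ℤ) ≤ f y := fun y hy h => by
    have := Nat.find_min' hex (m := (f y).toNat) ⟨by omega, y, hy, by omega⟩
    omega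
  rw [← hfn₀] at hmin
  have hfn₀pos : 0 < f n₀ := by omega
  obtain ⟨c₀, hc₀, hcn₀⟩ := mem_hull_singleton.1 hn₀
  have hc₀pos : 0 < c₀ := by
    refine hc₀.lt_of_ne' fun h0 => ?_
    have := hc _ _ hcn₀
    rw [h0, zero_mul] at this
    have : f n₀ = 0 := by exact_mod_cast this
    omega
  refine ⟨n₀, ?_, ?_, ?_⟩
  · rintro rfl
    simp at hfn₀pos
  · refine le_antisymm (Submodule.span_le.2 (by simpa using hn₀)) (Submodule.span_le.2 ?_)
    rw [Set.singleton_subset_iff]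
    refine mem_hull_singleton.2 ⟨c₀⁻¹, inv_nonneg.2 hc₀, ?_⟩
    rw [hcn₀, smul_smul, inv_mul_cancel₀ hc₀pos.ne', one_smul]
  · intro x hx
    obtain ⟨c, hc0, hcx⟩ := mem_hull_singleton.1 hx
    have hfx : 0 ≤ f x := by
      have : (0 : ℝ) ≤ f x := by rw [hc x c hcx]; positivity
      exact_mod_cast this
    -- division with remainder by the generator
    set y := x - (f x / f n₀) • n₀ with hy
    have hfy : f y = f x % f n₀ := by
      rw [hy, map_sub, map_zsmul, smul_eq_mul, Int.emod_def, mul_comm]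
    have hy1 : toReal y = (c - (f x / f n₀ : ℤ) * c₀) • toReal n := by
      rw [hy, map_sub, map_zsmul, hcx, hcn₀, sub_smul, mul_smul, Int.cast_smul_eq_zsmul]
    have hy2 := hc _ _ hy1
    have hrem0 : 0 ≤ f y := hfy ▸ Int.emod_nonneg _ hfn₀pos.ne'
    have hcoef : 0 ≤ c - (f x / f n₀ : ℤ) * c₀ := by
      by_contra! hneg
      have := mul_neg_of_neg_of_pos hneg hfR
      rw [← hy2] at this
      have : f y < 0 := by exact_mod_cast this
      omega
    have hyray : toReal y ∈ PointedCone.hull ℝ {toReal n} := mem_hull_singleton.2 ⟨_, hcoef, hy1⟩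
    have hfy0 : f y = 0 := by
      by_contra hne
      have h1 := hmin y hyray (by omega)
      have h2 := Int.emod_lt_of_pos (f x) hfn₀pos
      omega
    have hy0 : y = 0 := by
      refine toReal_injective ?_
      rw [hfy0, Int.cast_zero] at hy2
      rcases mul_eq_zero.1 hy2.symm with h | h
      · rw [hy1, h, zero_smul, map_zero]
      · exact absurd h hfR.ne'
    refine ⟨(f x / f n₀).toNat, ?_⟩
    have hq : 0 ≤ f x / f n₀ := Int.ediv_nonneg hfx hfn₀pos.le
    rw [← natCast_zsmul, Int.toNat_of_nonneg hq]
    exact sub_eq_zero.1 (hy ▸ hy0)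

/-- A pointed rational polyhedral cone is generated by the integer generators of finitely many of
its one-dimensional faces, namely those spanned by the members of a minimal generating set. -/
theorem exists_rayGenerators {K : PointedCone ℝ (ℝ ⊗[ℤ] N)} (hK : IsRationalPolyhedral K)
    (hp : ∀ x ∈ K, -x ∈ K → x = 0) :
    ∃ t : Finset N, (∀ n ∈ t, IsRayGenerator K n) ∧
      K = PointedCone.hull ℝ (toReal '' (t : Set N)) := by
  classical
  have hex : ∃ k : ℕ, ∃ s : Finset N, s.card = k ∧
      K = PointedCone.hull ℝ (toReal '' (s : Set N)) := by
    obtain ⟨s, hs⟩ := hK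
    exact ⟨_, s, rfl, hs⟩
  -- a generating set of least cardinality
  obtain ⟨s, hcard, hs⟩ := Nat.find_spec hex
  have hmin : ∀ n ∈ s,
      toReal n ∉ PointedCone.hull ℝ (toReal '' ((s.erase n : Finset N) : Set N)) := by
    intro n hn hmem
    have hlt := Finset.card_erase_lt_of_mem hn
    rw [hcard] at hlt
    refine Nat.find_min hex hlt ⟨s.erase n, rfl, ?_⟩
    rw [hs]
    refine le_antisymm (Submodule.span_le.2 ?_)
      (Submodule.span_mono (Set.image_mono (by simp)))
    rintro _ ⟨x, hx, rfl⟩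
    by_cases hxn : x = n
    · exact hxn ▸ hmem
    · exact Submodule.subset_span ⟨x, by simpa [hxn] using hx, rfl⟩
  have hface : ∀ n ∈ s, (PointedCone.hull ℝ {toReal n}).IsFaceOf K := by
    intro n hn
    set H := PointedCone.hull ℝ (toReal '' ((s.erase n : Finset N) : Set N)) with hH
    set v := toReal n with hv
    have hvK : v ∈ K := hs ▸ Submodule.subset_span ⟨n, hn, rfl⟩
    have hHK : H ≤ K := hs ▸ Submodule.span_mono (Set.image_mono (by simp))
    have hdec : ∀ x ∈ K, ∃ c : ℝ, 0 ≤ c ∧ ∃ z ∈ H, x = c • v + z := by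
      intro x hx
      have : toReal '' (s : Set N) = insert v (toReal '' ((s.erase n : Finset N) : Set N)) := by
        rw [hv, ← Set.image_insert_eq, ← Finset.coe_insert, Finset.insert_erase hn]
      rw [hs, this, PointedCone.hull, Submodule.mem_span_insert] at hx
      obtain ⟨c, z, hz, rfl⟩ := hx
      exact ⟨c, c.2, z, hz, rfl⟩
    refine ⟨Submodule.span_le.2 (by simpa using hvK), fun {x y a} hx hy ha hxy => ?_⟩
    obtain ⟨α, hα, x', hx', rfl⟩ := hdec x hx
    obtain ⟨β, hβ, y', hy', rfl⟩ := hdec y hy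
    obtain ⟨c, hc, hcv⟩ := mem_hull_singleton.1 hxy
    have hax' : a • x' ∈ H := H.smul_mem ha.le hx'
    have hz : a • x' + y' = (c - a * α - β) • v := by
      rw [sub_smul, sub_smul, ← hcv, mul_smul, smul_add]
      abel
    -- otherwise `v` would lie in the cone over the other generators
    have hγ : c - a * α - β ≤ 0 := by
      by_contra! hpos
      refine hmin n hn ?_
      have h1 : (c - a * α - β)⁻¹ • (a • x' + y') ∈ H :=
        H.smul_mem (inv_pos.2 hpos).le (H.add_mem hax' hy')
      rwa [hz, smul_smul, inv_mul_cancel₀ hpos.ne', one_smul] at h1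
    have hz0 : a • x' + y' = 0 := by
      refine hp _ (hHK (H.add_mem hax' hy')) ?_
      rw [hz, ← neg_smul]
      exact K.smul_mem (by linarith) hvK
    have hx0 : a • x' = 0 := by
      refine hp _ (hHK hax') ?_
      rw [neg_eq_of_add_eq_zero_right hz0]
      exact hHK hy'
    have hx0' : x' = 0 := (smul_eq_zero.1 hx0).resolve_left ha.ne'
    exact mem_hull_singleton.2 ⟨α, hα, by rw [hx0', add_zero]⟩
  have hne : ∀ n ∈ s, n ≠ 0 := by
    rintro _ hn rfl
    refine hmin 0 hn ?_
    rw [map_zero]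
    exact Submodule.zero_mem _
  have hgen : ∀ n ∈ s, ∃ n₀ : N, IsRayGenerator K n₀ ∧
      PointedCone.hull ℝ {toReal n₀} = PointedCone.hull ℝ {toReal n} := by
    intro n hn
    obtain ⟨n₀, h0, h1, h2⟩ := exists_generator (hne n hn)
    exact ⟨n₀, ⟨h0, h1 ▸ hface n hn, h1 ▸ h2⟩, h1⟩
  choose! γ hγ1 hγ2 using hgen
  refine ⟨s.image γ, ?_, ?_⟩
  · intro n hn
    obtain ⟨n', hn', rfl⟩ := Finset.mem_image.1 hn
    exact hγ1 n' hn'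
  · rw [hs]
    refine le_antisymm (Submodule.span_le.2 ?_) (Submodule.span_le.2 ?_)
    · rintro _ ⟨n, hn, rfl⟩
      have h1 : toReal n ∈ PointedCone.hull ℝ {toReal (γ n)} :=
        hγ2 n hn ▸ PointedCone.subset_hull rfl
      refine Submodule.span_mono ?_ h1
      rintro _ rfl
      exact ⟨γ n, Finset.mem_coe.2 (Finset.mem_image_of_mem γ hn), rfl⟩
    · rintro _ ⟨m, hm, rfl⟩
      obtain ⟨n, hn, rfl⟩ := Finset.mem_image.1 (Finset.mem_coe.1 hm)
      have h1 : toReal (γ n) ∈ PointedCone.hull ℝ {toReal n} :=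
        hγ2 n hn ▸ PointedCone.subset_hull rfl
      refine Submodule.span_mono ?_ h1
      rintro _ rfl
      exact ⟨n, hn, rfl⟩

end Rays

/-! ### Small shifts of a graded cone -/

section Shifts

variable {N : Type*} [AddCommGroup N] {d : ℕ} {e : Fin d → N}

section Interior

variable {K : PointedCone ℝ (ℝ ⊗[ℤ] N)}

/-- A strictly positive combination of spanning generators is an interior point. -/
theorem sum_smul_mem_openCone (hK : K = PointedCone.hull ℝ (Set.range fun l => toReal (e l)))
    (σ : Frame fun l => toReal (e l)) {a : Fin d → ℝ} (ha : ∀ l, 0 < a l) :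
    ∑ l, a l • toReal (e l) ∈ openCone K := by
  classical
  let _ : TopologicalSpace (ℝ ⊗[ℤ] N) := moduleTopology ℝ (ℝ ⊗[ℤ] N)
  have : IsModuleTopology ℝ (ℝ ⊗[ℤ] N) := ⟨rfl⟩
  have hsplit : ∑ l, a l • toReal (e l) = ∑ l, (if l ∈ σ.1 then 0 else a l) • toReal (e l) +
      ∑ l, (if l ∈ σ.1 then a l else 0) • toReal (e l) := by
    rw [← Finset.sum_add_distrib]
    refine Finset.sum_congr rfl fun l _ => ?_
    split_ifs <;> simp
  rw [hsplit]
  refine add_mem_openCone ?_ ?_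
  · rw [hK]
    refine mem_hull_range.2 ⟨_, fun l => ?_, rfl⟩
    split_ifs
    · exact le_rfl
    · exact (ha l).le
  · have hopen : IsOpen {x : ℝ ⊗[ℤ] N | ∀ l ∈ σ.1, 0 < σ.coord x l} := by
      have hc : Continuous σ.coord := IsModuleTopology.continuous_of_linearMap σ.coord
      have : {x : ℝ ⊗[ℤ] N | ∀ l ∈ σ.1, 0 < σ.coord x l} =
          ⋂ l ∈ σ.1, {x | 0 < σ.coord x l} := by
        ext x
        simp
      rw [this]
      exact isOpen_biInter_finset fun l _ =>
        isOpen_lt continuous_const ((continuous_apply l).comp hc)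
    have hsub : {x : ℝ ⊗[ℤ] N | ∀ l ∈ σ.1, 0 < σ.coord x l} ⊆ K := by
      intro x hx
      rw [hK]
      refine mem_hull_range.2 ⟨σ.coord x, fun l => ?_, σ.sum_coord x⟩
      by_cases hl : l ∈ σ
      · exact (hx l hl).le
      · exact (σ.coord_of_notMem x hl).ge
    refine interior_maximal hsub hopen ?_
    intro l hl
    rw [σ.coord_sum (a := fun l => if l ∈ σ.1 then a l else 0) fun l hl => if_neg hl]
    simpa [hl] using ha l

/-- From an interior point of the cone a short step in any direction stays in the cone. -/
theorem exists_sub_smul_mem {x : ℝ ⊗[ℤ] N} (hx : x ∈ openCone K) (y : ℝ ⊗[ℤ] N) :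
    ∃ t : ℝ, 0 < t ∧ t ≤ 1 ∧ x - t • y ∈ K := by
  let _ : TopologicalSpace (ℝ ⊗[ℤ] N) := moduleTopology ℝ (ℝ ⊗[ℤ] N)
  have : IsModuleTopology ℝ (ℝ ⊗[ℤ] N) := ⟨rfl⟩
  have : ContinuousAdd (ℝ ⊗[ℤ] N) := ModuleTopology.continuousAdd ℝ (ℝ ⊗[ℤ] N)
  have : ContinuousSMul ℝ (ℝ ⊗[ℤ] N) := ModuleTopology.continuousSMul ℝ (ℝ ⊗[ℤ] N)
  have hc : Continuous fun t : ℝ => x + t • -y := by fun_prop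
  have hmem : (K : Set (ℝ ⊗[ℤ] N)) ∈ nhds (x + (0 : ℝ) • -y) := by
    rw [zero_smul, add_zero]
    exact mem_interior_iff_mem_nhds.1 hx
  have hev := ((hc.tendsto 0).mono_left (nhdsWithin_le_nhds (s := Set.Ioi 0))).eventually hmem
  have hlt : ∀ᶠ t : ℝ in nhdsWithin 0 (Set.Ioi 0), t < 1 :=
    nhdsWithin_le_nhds (gt_mem_nhds one_pos)
  obtain ⟨t, ⟨ht, ht1⟩, ht0⟩ := ((hev.and hlt).and self_mem_nhdsWithin).exists
  refine ⟨t, ht0, ht1.le, ?_⟩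
  rw [sub_eq_add_neg, ← smul_neg]
  exact ht

end Interior

variable [Module.Free ℤ N] [Module.Finite ℤ N]

/-- The lattice points have bounded denominators in the coordinates of the frames. -/
theorem exists_denominator (e : Fin d → N) : ∃ q : ℕ, 0 < q ∧
    ∀ (σ : Frame fun l => toReal (e l)) (n : N) (l : Fin d),
      ∃ z : ℤ, (q : ℝ) * σ.coord (toReal n) l = z := by
  classical
  have key : ∀ σ : Frame fun l => toReal (e l), ∃ q : ℕ, 0 < q ∧ ∀ (n : N) (l : Fin d),
      ∃ z : ℤ, (q : ℝ) * σ.coord (toReal n) l = z := by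
    intro σ
    have hliR : LinearIndependent ℝ (fun i : (σ.1 : Set (Fin d)) => toReal (e i)) := σ.2.1
    have hspan : ⊤ ≤ Submodule.span ℝ
        (Set.range fun i : (σ.1 : Set (Fin d)) => toReal (e i)) := by
      have := σ.2.2
      rwa [Set.image_eq_range] at this
    have hli : LinearIndependent ℤ (fun i : (σ.1 : Set (Fin d)) => e i) := by
      have h1 : LinearIndependent ℤ (fun i : (σ.1 : Set (Fin d)) => toReal (e i)) :=
        hliR.restrict_scalars' ℤ
      exact LinearIndependent.of_comp (toReal : N →+ ℝ ⊗[ℤ] N).toIntLinearMap h1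
    set S := Submodule.span ℤ (Set.range fun i : (σ.1 : Set (Fin d)) => e i) with hS
    have hrank : Module.finrank ℤ S = Module.finrank ℤ N := by
      rw [hS, finrank_span_eq_card hli, ← Module.finrank_baseChange (R := ℝ) (S := ℤ) (M' := N),
        Module.finrank_eq_card_basis (Module.Basis.mk hliR hspan)]
    have hfin := S.finiteQuotientOfFreeOfRankEq hrank
    -- the index of the sublattice spanned by the frame clears the denominators
    refine ⟨Nat.card (N ⧸ S), Nat.card_pos, fun n l => ?_⟩
    have hmem : Nat.card (N ⧸ S) • n ∈ S := by
      rw [← Submodule.Quotient.mk_eq_zero, ← Submodule.mkQ_apply, map_nsmul]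
      exact card_nsmul_eq_zero'
    generalize Nat.card (N ⧸ S) = q at hmem
    have hz : ∀ x ∈ S, ∃ z : ℤ, σ.coord (toReal x) l = z := by
      intro x hx
      refine Submodule.span_induction ?_ ?_ ?_ ?_ hx
      · rintro _ ⟨i, rfl⟩
        refine ⟨(Pi.single (i : Fin d) 1 : Fin d → ℤ) l, ?_⟩
        have h := σ.coord_self i.2
        simp only at h ⊢
        rw [h]
        by_cases hl : l = i
        · rw [hl]; simp
        · simp [hl]
      · exact ⟨0, by simp⟩
      · rintro x y - - ⟨z, hz⟩ ⟨w, hw⟩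
        exact ⟨z + w, by rw [map_add, map_add, Pi.add_apply, hz, hw, Int.cast_add]⟩
      · rintro a x - ⟨z, hz⟩
        exact ⟨a * z, by rw [map_zsmul, map_zsmul, Pi.smul_apply, hz]; simp⟩
    obtain ⟨z, hz⟩ := hz _ hmem
    refine ⟨z, ?_⟩
    rw [← hz, map_nsmul, map_nsmul, Pi.smul_apply, nsmul_eq_mul]
  choose q hq hqz using key
  have := Fintype.ofFinite (Frame fun l => toReal (e l))
  refine ⟨∏ σ, q σ, Finset.prod_pos fun σ _ => hq σ, fun σ n l => ?_⟩
  obtain ⟨z, hz⟩ := hqz σ n l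
  refine ⟨(∏ τ ∈ Finset.univ.erase σ, q τ : ℕ) * z, ?_⟩
  rw [← Finset.mul_prod_erase _ _ (Finset.mem_univ σ)]
  push_cast
  rw [← hz]
  ring

/-- Heights on a finite family that define a regular triangulation of its cone: they avoid the
hyperplanes on which a vector outside a frame lies on the graph of the linear form of the frame. -/
theorem exists_generic_height {E : Type*} [AddCommGroup E] [Module ℝ E] (v : Fin d → E) :
    ∃ h : Fin d → ℝ, ∀ σ : Frame v, ∀ l ∉ σ, σ.height h (v l) ≠ h l := by
  classical
  obtain ⟨h, -, hh⟩ := Frame.exists_pos_forall_sum_ne_zero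
    (κ := {p : Frame v × Fin d // p.2 ∉ p.1})
    (fun p => p.1.1.coord (v p.1.2) - Pi.single p.1.2 1) (fun p h0 => by
      have := congrFun h0 p.1.2
      rw [Pi.sub_apply, p.1.1.coord_of_notMem _ p.2] at this
      simp at this)
  refine ⟨h, fun σ l hl heq => hh ⟨(σ, l), hl⟩ ?_⟩
  simp only [Pi.sub_apply, sub_mul, Finset.sum_sub_distrib]
  rw [Frame.height_apply] at heq
  simp only [mul_comm (h _)] at heq
  rw [heq]
  simp [Pi.single_apply]

/-- A positive combination of the family that lies on no wall of a frame and is so small that its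
coordinates cannot change the sign of a nonzero coordinate of a lattice point. -/
theorem exists_small_shift {E : Type*} [AddCommGroup E] [Module ℝ E] (v : Fin d → E) (q : ℕ) :
    ∃ a : Fin d → ℝ, (∀ l, 0 < a l) ∧ ∀ σ : Frame v, ∀ l,
      |(q : ℝ) * σ.coord (∑ k, a k • v k) l| < 1 ∧ (l ∈ σ → σ.coord (∑ k, a k • v k) l ≠ 0) := by
  classical
  obtain ⟨a, ha, hne⟩ := Frame.exists_pos_forall_sum_ne_zero
    (κ := {p : Frame v × Fin d // p.2 ∈ p.1})
    (fun p k => p.1.1.coord (v k) p.1.2) (fun p h0 => by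
      have := congrFun h0 p.1.2
      rw [p.1.1.coord_self p.2] at this
      simp at this)
  have hcoord : ∀ (σ : Frame v) (t : ℝ) (l : Fin d),
      σ.coord (∑ k, (t * a k) • v k) l = t * ∑ k, σ.coord (v k) l * a k := by
    intro σ t l
    rw [map_sum, Finset.sum_apply, Finset.mul_sum]
    refine Finset.sum_congr rfl fun k _ => ?_
    rw [map_smul, Pi.smul_apply, smul_eq_mul]
    ring
  have hev : ∀ᶠ t in nhdsWithin (0 : ℝ) (Set.Ioi 0), ∀ p : Frame v × Fin d,
      |(q : ℝ) * (t * ∑ k, p.1.coord (v k) p.2 * a k)| < 1 := by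
    rw [Filter.eventually_all]
    intro p
    have hc : Continuous fun t : ℝ => |(q : ℝ) * (t * ∑ k, p.1.coord (v k) p.2 * a k)| := by
      fun_prop
    have := (hc.tendsto 0).mono_left (nhdsWithin_le_nhds (s := Set.Ioi 0))
    simp only [zero_mul, mul_zero, abs_zero] at this
    exact this.eventually (gt_mem_nhds one_pos)
  obtain ⟨t, ht, ht0⟩ := (hev.and self_mem_nhdsWithin).exists
  have ht0 : 0 < t := ht0
  refine ⟨fun k => t * a k, fun k => mul_pos ht0 (ha k), fun σ l => ⟨?_, fun hl => ?_⟩⟩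
  · rw [hcoord]
    exact ht (σ, l)
  · rw [hcoord]
    exact mul_ne_zero ht0.ne' (hne ⟨(σ, l), hl⟩)

/-- A cone generated in degree one has a triangulation with two opposite small shifts, by an
interior vector `u` and by `-u`. Since lattice points have bounded denominators in the coordinates
of all frames, `n + u` lies in the cone exactly if `n` does, and `n - u` lies in the cone exactly if
`n` lies in its interior. -/
theorem exists_shiftedCones {K : PointedCone ℝ (ℝ ⊗[ℤ] N)} {deg : N →+ ℤ}
    (hdeg : ∀ l, deg (e l) = 1)
    (hK : K = PointedCone.hull ℝ (Set.range fun l => toReal (e l)))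
    (hfull : ∀ v : ℝ ⊗[ℤ] N, ∃ x ∈ K, ∃ y ∈ K, v = x - y) :
    ∃ C C' : ShiftedCone N (ℝ ⊗[ℤ] N) d, C.e = e ∧ C'.e = e ∧
      (∀ n, n ∈ C.points ↔ toReal n ∈ K) ∧ (∀ n, n ∈ C'.points ↔ toReal n ∈ openCone K) ∧
      toReal (∑ l, e l) ∈ openCone K := by
  classical
  obtain ⟨φ, hφ⟩ := exists_extend_toReal ((Int.castAddHom ℝ).comp deg)
  have hφ : ∀ n, φ (toReal n) = deg n := hφ
  have hφe : ∀ l, φ (toReal (e l)) = 1 := fun l => by rw [hφ, hdeg, Int.cast_one]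
  have hspan : Submodule.span ℝ (Set.range fun l => toReal (e l)) = ⊤ := by
    refine eq_top_iff.2 fun v _ => ?_
    have hle := hK ▸ PointedCone.hull_le_span ℝ (Set.range fun l => toReal (e l))
    obtain ⟨x, hx, y, hy, rfl⟩ := hfull v
    exact Submodule.sub_mem _ (hle hx) (hle hy)
  obtain ⟨h, hh⟩ := exists_generic_height fun l => toReal (e l)
  obtain ⟨q, hq, hqz⟩ := exists_denominator e
  obtain ⟨a, ha, hau⟩ := exists_small_shift (fun l => toReal (e l)) q
  have hqR : (0 : ℝ) < q := by exact_mod_cast hq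
  set u := ∑ k, a k • toReal (e k) with hu
  have hne : ∀ (σ : Frame fun l => toReal (e l)) (n : N), ∀ l ∈ σ, ∀ ε : ℝ, |ε| = 1 →
      σ.coord (toReal n + ε • u) l ≠ 0 := by
    intro σ n l hl ε hε h0
    obtain ⟨z, hz⟩ := hqz σ n l
    obtain ⟨h1, h2⟩ := hau σ l
    rw [map_add, map_smul, Pi.add_apply, Pi.smul_apply, smul_eq_mul] at h0
    have h3 : (z : ℝ) = -ε * (q * σ.coord u l) := by
      rw [← hz]
      linear_combination (q : ℝ) * h0
    have h4 : |(z : ℝ)| < 1 := by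
      rw [h3, abs_mul, abs_neg, hε, one_mul]
      exact h1
    have h5 : z = 0 := by
      have : |z| < 1 := by exact_mod_cast h4
      exact Int.abs_lt_one_iff.1 this
    rw [h5, Int.cast_zero, eq_comm, neg_mul, neg_eq_zero] at h3
    rcases mul_eq_zero.1 h3 with h6 | h6
    · rw [h6] at hε
      simp at hε
    · exact (mul_ne_zero hqR.ne' (h2 hl)) h6
  have hbox : ∀ (σ : Frame fun l => toReal (e l)) (w : ℝ ⊗[ℤ] N),
      {n : N | ∀ l, 0 ≤ σ.coord (toReal n + w) l ∧ σ.coord (toReal n + w) l < 1}.Finite := by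
    intro σ w
    let F : N → Fin d → ℤ := fun n l => ⌊(q : ℝ) * σ.coord (toReal n) l⌋
    have hF : ∀ n l, (F n l : ℝ) = q * σ.coord (toReal n) l := by
      intro n l
      obtain ⟨z, hz⟩ := hqz σ n l
      simp only [F, hz, Int.floor_intCast]
    have hinj : Function.Injective F := by
      intro n n' hnn
      refine toReal_injective ?_
      rw [← σ.sum_coord (toReal n), ← σ.sum_coord (toReal n')]
      refine Finset.sum_congr rfl fun l _ => ?_
      have := hF n l
      rw [hnn, hF n' l] at this
      rw [mul_left_cancel₀ hqR.ne' this]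
    refine Set.Finite.of_finite_image ((Set.finite_Icc (fun l => ⌊-(q * σ.coord w l)⌋)
      (fun l => ⌈q - q * σ.coord w l⌉)).subset ?_) hinj.injOn
    rintro _ ⟨n, hn, rfl⟩
    have key : ∀ l, -(q * σ.coord w l) ≤ (F n l : ℝ) ∧ (F n l : ℝ) ≤ q - q * σ.coord w l := by
      intro l
      have h1 := hn l
      rw [map_add, Pi.add_apply] at h1
      have h2 := mul_nonneg hqR.le h1.1
      have h3 := mul_le_mul_of_nonneg_left h1.2.le hqR.le
      rw [hF]
      constructor <;> linarith
    refine ⟨fun l => ?_, fun l => ?_⟩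
    · exact_mod_cast (Int.floor_le _).trans (key l).1
    · exact_mod_cast (key l).2.trans (Int.le_ceil _)
  -- the triangulated cone with the shift `ε • u`, for a sign `ε`
  let mk : ∀ ε : ℝ, |ε| = 1 → ShiftedCone N (ℝ ⊗[ℤ] N) d := fun ε hε =>
    { toE := toReal
      e := e
      exists_extend := exists_extend_toReal
      deg := deg
      degE := φ
      degE_toE := hφ
      deg_e := hdeg
      span_eq_top := hspan
      h := h
      height_ne := hh
      u := ε • u
      coord_ne := fun σ n l hl => hne σ n l hl ε hε
      finite_box := fun σ => hbox σ (ε • u) }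
  have hpoints : ∀ ε hε n, n ∈ (mk ε hε).points ↔ toReal n + ε • u ∈ K := by
    intro ε hε n
    rw [hK, mem_hull_range]
    exact Iff.rfl
  obtain ⟨σ₀, -⟩ := Frame.exists_frame_le_height (e := fun l => toReal (e l)) φ hφe hspan 0 0 0
    (fun _ => le_rfl) (by simp)
  have huopen : u ∈ openCone K := sum_smul_mem_openCone hK σ₀ ha
  have huK : u ∈ K := by
    rw [hK]
    exact mem_hull_range.2 ⟨a, fun l => (ha l).le, rfl⟩
  have hcone : ∀ x ∈ K, ∃ σ : Frame fun l => toReal (e l), ∀ l, 0 ≤ σ.coord x l := by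
    intro x hx
    rw [hK] at hx
    obtain ⟨b, hb, hbx⟩ := mem_hull_range.1 hx
    obtain ⟨σ, hσ, -⟩ := Frame.exists_frame_le_height φ hφe hspan 0 x b hb hbx
    exact ⟨σ, hσ⟩
  have hmemK : ∀ (σ : Frame fun l => toReal (e l)) x, (∀ l, 0 ≤ σ.coord x l) → x ∈ K := by
    intro σ x hx
    rw [hK]
    exact mem_hull_range.2 ⟨_, hx, σ.sum_coord x⟩
  refine ⟨mk 1 abs_one, mk (-1) (by rw [abs_neg, abs_one]), rfl, rfl, fun n => ?_, fun n => ?_, ?_⟩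
  · rw [hpoints 1 abs_one, one_smul]
    refine ⟨fun hn => ?_, fun hn => K.add_mem hn huK⟩
    obtain ⟨σ, hσ⟩ := hcone _ hn
    refine hmemK σ _ fun l => ?_
    obtain ⟨z, hz⟩ := hqz σ n l
    have h1 := (abs_lt.1 (hau σ l).1).2
    have h2 := mul_nonneg hqR.le (hσ l)
    rw [map_add, Pi.add_apply, mul_add, hz] at h2
    have h3 : (-1 : ℝ) < z := by linarith
    have h4 : -1 < z := by exact_mod_cast h3
    have h5 : (0 : ℝ) ≤ z := by exact_mod_cast (by omega : 0 ≤ z)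
    rw [← hz] at h5
    exact nonneg_of_mul_nonneg_right h5 hqR
  · rw [hpoints (-1) (by rw [abs_neg, abs_one]), neg_one_smul, ← sub_eq_add_neg]
    refine ⟨fun hn => ?_, fun hn => ?_⟩
    · have := add_mem_openCone hn huopen
      rwa [sub_add_cancel] at this
    · obtain ⟨t, ht, ht1, htK⟩ := exists_sub_smul_mem hn u
      obtain ⟨σ, hσ⟩ := hcone _ htK
      refine hmemK σ _ fun l => ?_
      obtain ⟨z, hz⟩ := hqz σ n l
      obtain ⟨h1, h2⟩ := abs_lt.1 (hau σ l).1
      have h3 := mul_nonneg hqR.le (hσ l)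
      rw [map_sub, Pi.sub_apply, map_smul, Pi.smul_apply, smul_eq_mul, mul_sub, hz] at h3
      rw [map_sub, Pi.sub_apply]
      refine nonneg_of_mul_nonneg_right ?_ hqR
      rw [mul_sub, hz]
      rcases le_or_gt z 0 with hz0 | hz0
      · -- the coordinate of the lattice point is not positive, so the shift decreases it
        have hz0' : (z : ℝ) ≤ 0 := by exact_mod_cast hz0
        have h3' : 0 ≤ z - t * (q * σ.coord u l) := by rwa [mul_left_comm] at h3
        have h4 : q * σ.coord u l ≤ 0 := by
          by_contra! h
          have := mul_pos ht h
          linarith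
        have h5 : z = 0 := by
          have h6 := mul_lt_mul_of_pos_left h1 ht
          have h7 : (-1 : ℝ) < z := by linarith
          have h8 : -1 < z := by exact_mod_cast h7
          omega
        rw [h5, Int.cast_zero]
        linarith
      · have : (1 : ℝ) ≤ z := by exact_mod_cast hz0
        linarith
  · have := sum_smul_mem_openCone hK σ₀ (a := fun _ => 1) fun _ => one_pos
    simpa [map_sum] using this

end Shifts

/-! ### Semigroup rings of graded cones -/

section Bridge

variable {N : Type*} [AddCommGroup N]

/-- The inclusion of the semigroup ring into the group ring of the lattice. -/
def toGroupRing (K : PointedCone ℝ (ℝ ⊗[ℤ] N)) : semigroupRing K →ₐ[ℂ] AddMonoidAlgebra ℂ N :=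
  AddMonoidAlgebra.mapDomainAlgHom ℂ ℂ (latticePoints K).subtype

variable {K : PointedCone ℝ (ℝ ⊗[ℤ] N)}

theorem coeff_toGroupRing (x : semigroupRing K) :
    (toGroupRing K x).coeff = x.coeff.mapDomain Subtype.val := rfl

theorem toGroupRing_injective : Function.Injective (toGroupRing K) := by
  intro x y h
  have h1 := congrArg AddMonoidAlgebra.coeff h
  rw [coeff_toGroupRing, coeff_toGroupRing] at h1
  exact AddMonoidAlgebra.coeff_injective (Finsupp.mapDomain_injective Subtype.val_injective h1)

theorem mem_range_toGroupRing (x : AddMonoidAlgebra ℂ N) :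
    x ∈ Set.range (toGroupRing K) ↔ ∀ n, x.coeff n ≠ 0 → toReal n ∈ K := by
  constructor
  · rintro ⟨y, rfl⟩ n hn
    by_contra hK
    rw [coeff_toGroupRing, Finsupp.mapDomain_of_notMem_range] at hn
    · exact hn rfl
    · rintro ⟨m, rfl⟩
      exact hK m.2
  · intro h
    refine ⟨AddMonoidAlgebra.ofCoeff (x.coeff.comapDomain Subtype.val
      Subtype.val_injective.injOn), AddMonoidAlgebra.coeff_injective ?_⟩
    rw [coeff_toGroupRing, AddMonoidAlgebra.coeff_ofCoeff]
    refine Finsupp.mapDomain_comapDomain _ Subtype.val_injective _ fun n hn => ?_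
    exact ⟨⟨n, h n (Finsupp.mem_support_iff.1 hn)⟩, rfl⟩

/-- The image of the interior ideal in the group ring. -/
theorem toGroupRing_mem_range_openIdeal (x : AddMonoidAlgebra ℂ N) :
    (∃ y ∈ openIdeal K, toGroupRing K y = x) ↔ ∀ n, x.coeff n ≠ 0 → toReal n ∈ openCone K := by
  constructor
  · rintro ⟨y, hy, rfl⟩ n hn
    obtain ⟨m, rfl⟩ : n ∈ Set.range (Subtype.val : latticePoints K → N) := by
      by_contra hr
      rw [coeff_toGroupRing, Finsupp.mapDomain_of_notMem_range _ _ hr] at hn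
      exact hn rfl
    refine hy m (Finsupp.mem_support_iff.2 ?_)
    rwa [coeff_toGroupRing, Finsupp.mapDomain_apply Subtype.val_injective] at hn
  · intro h
    obtain ⟨y, rfl⟩ := (mem_range_toGroupRing (K := K) x).2 fun n hn =>
      @interior_subset _ (moduleTopology ℝ (ℝ ⊗[ℤ] N)) _ _ (h n hn)
    refine ⟨y, fun m hm => h m ?_, rfl⟩
    rw [coeff_toGroupRing, Finsupp.mapDomain_apply Subtype.val_injective]
    exact Finsupp.mem_support_iff.1 hm

theorem exists_addEquiv_of_range_eq {X Y L : Type*} [AddCommGroup X] [AddCommGroup Y]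
    [AddCommGroup L] (p : X →+ L) (q : Y →+ L) (hp : Function.Injective p)
    (hq : Function.Injective q) (h : ∀ z, z ∈ Set.range p ↔ z ∈ Set.range q) :
    ∃ Φ : X ≃+ Y, ∀ x, q (Φ x) = p x := by
  choose f hf using fun x => (h (p x)).1 ⟨x, rfl⟩
  choose g hg using fun y => (h (q y)).2 ⟨y, rfl⟩
  exact ⟨{ toFun := f, invFun := g
           left_inv := fun x => hp (by rw [hg, hf])
           right_inv := fun y => hq (by rw [hf, hg])
           map_add' := fun x y => hq (by rw [map_add, hf, hf, hf, map_add]) }, hf⟩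

theorem pairing_add_left (m m' : ℂ ⊗[ℤ] Module.Dual ℤ N) (n : N) :
    pairing (m + m') n = pairing m n + pairing m' n := by
  simp only [pairing, map_add]

theorem pairing_zero_left (n : N) : pairing (0 : ℂ ⊗[ℤ] Module.Dual ℤ N) n = 0 := by
  simp only [pairing, map_zero]

theorem pairing_sum_left {ι : Type*} (s : Finset ι) (m : ι → ℂ ⊗[ℤ] Module.Dual ℤ N) (n : N) :
    pairing (∑ i ∈ s, m i) n = ∑ i ∈ s, pairing (m i) n := by
  simp only [pairing, map_sum]

theorem pairing_smul_left (z : ℂ) (m : ℂ ⊗[ℤ] Module.Dual ℤ N) (n : N) :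
    pairing (z • m) n = z * pairing m n := by
  induction m with
  | zero => rw [smul_zero, pairing_zero_left, mul_zero]
  | add x y hx hy => rw [smul_add, pairing_add_left, pairing_add_left, hx, hy, mul_add]
  | tmul w g =>
    rw [TensorProduct.smul_tmul', pairing_tmul, pairing_tmul, smul_eq_mul, mul_assoc]

theorem pairing_add_right (m : ℂ ⊗[ℤ] Module.Dual ℤ N) (n n' : N) :
    pairing m (n + n') = pairing m n + pairing m n' := by
  simp only [pairing, map_add, LinearMap.lTensor_add, LinearMap.add_apply]

/-- The additive map on the lattice given by the pairing with an element of `M ⊗ ℂ`. -/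
def pairingHom (m : ℂ ⊗[ℤ] Module.Dual ℤ N) : N →+ ℂ :=
  AddMonoidHom.mk' (pairing m) (pairing_add_right m)

theorem pairingHom_apply (m : ℂ ⊗[ℤ] Module.Dual ℤ N) (n : N) : pairingHom m n = pairing m n := rfl

/-- `M ⊗ ℂ` is the space of additive maps from the lattice to the complex numbers. -/
def pairingEquiv {r : ℕ} (b : Module.Basis (Fin r) ℤ N) :
    (ℂ ⊗[ℤ] Module.Dual ℤ N) ≃ₗ[ℂ] (N →+ ℂ) where
  toFun := pairingHom
  map_add' m m' := AddMonoidHom.ext fun n => pairing_add_left m m' n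
  map_smul' z m := AddMonoidHom.ext fun n => pairing_smul_left z m n
  invFun g := ∑ i, g (b i) ⊗ₜ[ℤ] b.coord i
  left_inv m := by
    simp only [pairingHom_apply]
    induction m with
    | zero => simp only [pairing_zero_left, TensorProduct.zero_tmul, Finset.sum_const_zero]
    | add x y hx hy =>
      simp only [pairing_add_left, TensorProduct.add_tmul, Finset.sum_add_distrib, hx, hy]
    | tmul w g =>
      have hg : g = ∑ i, g (b i) • b.coord i := by
        refine b.ext fun j => ?_
        simp
      conv_rhs => rw [hg, TensorProduct.tmul_sum]
      refine Finset.sum_congr rfl fun i _ => ?_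
      rw [pairing_tmul, ← TensorProduct.smul_tmul, zsmul_eq_mul, mul_comm]
  right_inv g := by
    refine AddMonoidHom.ext fun n => ?_
    rw [pairingHom_apply, pairing_sum_left]
    conv_rhs => rw [← b.sum_repr n, map_sum]
    refine Finset.sum_congr rfl fun i _ => ?_
    rw [pairing_tmul, map_zsmul, zsmul_eq_mul, mul_comm, b.coord_apply]

theorem pairingEquiv_apply {r : ℕ} (b : Module.Basis (Fin r) ℤ N) (m : ℂ ⊗[ℤ] Module.Dual ℤ N)
    (n : N) : pairingEquiv b m n = pairing m n := rfl

variable [Module.Free ℤ N] [Module.Finite ℤ N]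

/-- For generic coefficients both the semigroup ring and its interior ideal are free of finite
positive rank over the polynomial ring in the linear elements. -/
theorem exists_polynomial_free {r d : ℕ} (hr : Module.finrank ℤ N = r) {deg : Module.Dual ℤ N}
   
    (hfull : ∀ v : ℝ ⊗[ℤ] N, ∃ x ∈ K, ∃ y ∈ K, v = x - y) (e : Fin d → latticePoints K) (hdeg : ∀ l, deg (e l : N) = 1)
    (hKe : K = PointedCone.hull ℝ (Set.range fun l => toReal (e l : N)))
    (m : Module.Basis (Fin r) ℂ (ℂ ⊗[ℤ] Module.Dual ℤ N)) :
    ∃ P : MvPolynomial (Fin d) ℂ, P ≠ 0 ∧ ∀ a : Fin d → ℂ,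
      MvPolynomial.eval (fun l => Complex.exp (2 * Real.pi * Complex.I * a l)) P ≠ 0 →
      ∃ φ : MvPolynomial (Fin r) ℂ →ₐ[ℂ] semigroupRing K,
        (∀ j, φ (MvPolynomial.X j) = linearElement K e a (m j)) ∧
        (∃ B : Set N, B.Finite ∧ B.Nonempty ∧
          ∃ Φ : (B →₀ MvPolynomial (Fin r) ℂ) ≃+ semigroupRing K,
            ∀ x y, Φ (x • y) = φ x • Φ y) ∧
        (∃ B : Set N, B.Finite ∧ B.Nonempty ∧
          ∃ Φ : (B →₀ MvPolynomial (Fin r) ℂ) ≃+ openIdeal K,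
            ∀ x y, Φ (x • y) = φ x • Φ y) := by
  classical
  obtain ⟨C, C', hCe, hCe', hC, hC', hint⟩ := exists_shiftedCones (e := fun l => (e l : N))
    (deg := deg.toAddMonoidHom) hdeg hKe hfull
  let b := Module.finBasisOfFinrankEq ℤ N hr
  let f := m.map (pairingEquiv b)
  obtain ⟨P, hP, hPC⟩ := ShiftedCone.exists_polynomial_presentation f C
  obtain ⟨P', hP', hPC'⟩ := ShiftedCone.exists_polynomial_presentation f C'
  refine ⟨P * P', mul_ne_zero hP hP', fun a ha => ?_⟩
  rw [map_mul] at ha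
  set c : Fin d → ℂ := fun l => Complex.exp (2 * Real.pi * Complex.I * a l) with hc
  obtain ⟨hinj, hrange⟩ := hPC c (left_ne_zero_of_mul ha)
  obtain ⟨hinj', hrange'⟩ := hPC' c (right_ne_zero_of_mul ha)
  let φ : MvPolynomial (Fin r) ℂ →ₐ[ℂ] semigroupRing K :=
    MvPolynomial.aeval fun j => linearElement K e a (m j)
  have hφX : ∀ j, φ (MvPolynomial.X j) = linearElement K e a (m j) := fun j =>
    MvPolynomial.aeval_X _ j
  have hlin : ∀ D : ShiftedCone N (ℝ ⊗[ℤ] N) d, D.e = (fun l => (e l : N)) →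
      ∀ x, toGroupRing K (φ x) = D.evalLin f c x := by
    intro D hD x
    refine DFunLike.congr_fun (f := (toGroupRing K).comp φ) (MvPolynomial.algHom_ext fun j => ?_) x
    rw [AlgHom.comp_apply, hφX, ShiftedCone.evalLin, MvPolynomial.aeval_X,
      ShiftedCone.linElement_apply, hD, linearElement, map_sum]
    refine Finset.sum_congr rfl fun l _ => ?_
    simp [toGroupRing, f, pairingEquiv_apply, hc]
  refine ⟨φ, hφX, ?_, ?_⟩
  · have h0 : (0 : N) ∈ C.points := (hC 0).2 (by rw [map_zero]; exact K.zero_mem)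
    obtain ⟨Φ, hΦ⟩ := exists_addEquiv_of_range_eq (C.presentation f c).toAddMonoidHom
      (toGroupRing K).toRingHom.toAddMonoidHom hinj toGroupRing_injective fun z =>
        (hrange z).trans (by simp only [hC]; exact (mem_range_toGroupRing z).symm)
    have hΦ : ∀ x, toGroupRing K (Φ x) = C.presentation f c x := hΦ
    refine ⟨C.box, ShiftedCone.box_finite, ⟨_, ShiftedCone.base_mem_box h0⟩, Φ, fun x y => ?_⟩
    refine toGroupRing_injective ?_
    rw [hΦ, ShiftedCone.presentation_smul, smul_eq_mul, map_mul, hlin C hCe, hΦ]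
  · obtain ⟨Φ, hΦ⟩ := exists_addEquiv_of_range_eq (C'.presentation f c).toAddMonoidHom
      ((toGroupRing K).toLinearMap.toAddMonoidHom.comp (openIdeal K).subtype.toAddMonoidHom) hinj'
      (toGroupRing_injective.comp Subtype.val_injective) fun z => (hrange' z).trans (by
        simp only [hC']
        rw [← toGroupRing_mem_range_openIdeal]
        constructor
        · rintro ⟨y, hy, rfl⟩
          exact ⟨⟨y, hy⟩, rfl⟩
        · rintro ⟨y, rfl⟩
          exact ⟨y, y.2, rfl⟩)
    have hΦ : ∀ x, toGroupRing K (Φ x : semigroupRing K) = C'.presentation f c x := hΦ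
    refine ⟨C'.box, ShiftedCone.box_finite,
      ⟨_, ShiftedCone.base_mem_box ((hC' _).2 hint)⟩, Φ, fun x y => ?_⟩
    refine Subtype.ext (toGroupRing_injective ?_)
    rw [hΦ, ShiftedCone.presentation_smul, Submodule.coe_smul, smul_eq_mul, map_mul, hlin C' hCe',
      hΦ]

/-- Every proper Zariski closed subset misses some point of the torus, and the points of the torus
are the values of the exponential. -/
theorem exists_exp_eval_ne_zero {d : ℕ} {P : MvPolynomial (Fin d) ℂ} (hP : P ≠ 0) :
    ∃ a : Fin d → ℂ,
      MvPolynomial.eval (fun l => Complex.exp (2 * Real.pi * Complex.I * a l)) P ≠ 0 := by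
  have hne : P * ∏ l, MvPolynomial.X l ≠ 0 :=
    mul_ne_zero hP (Finset.prod_ne_zero_iff.2 fun l _ => MvPolynomial.X_ne_zero l)
  obtain ⟨c, hc⟩ : ∃ c : Fin d → ℂ, MvPolynomial.eval c (P * ∏ l, MvPolynomial.X l) ≠ 0 := by
    by_contra! H
    exact hne (MvPolynomial.funext fun c => by rw [H c, map_zero])
  rw [map_mul, map_prod] at hc
  simp only [MvPolynomial.eval_X] at hc
  have hc0 : ∀ l, c l ≠ 0 := fun l =>
    Finset.prod_ne_zero_iff.1 (right_ne_zero_of_mul hc) l (Finset.mem_univ l)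
  refine ⟨fun l => Complex.log (c l) / (2 * Real.pi * Complex.I), ?_⟩
  have : (fun l => Complex.exp (2 * Real.pi * Complex.I *
      (Complex.log (c l) / (2 * Real.pi * Complex.I)))) = c := by
    funext l
    rw [mul_div_cancel₀ _ Complex.two_pi_I_ne_zero, Complex.exp_log (hc0 l)]
  rw [this]
  exact left_ne_zero_of_mul hc

theorem finite_of_free {k : Type*} [Field k] {r : ℕ} {R B : Type*} [CommRing R] [Finite B]
    (φ : MvPolynomial (Fin r) k →+* R) (Φ : (B →₀ MvPolynomial (Fin r) k) ≃+ R)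
    (hΦ : ∀ a x, Φ (a • x) = φ a • Φ x) : φ.Finite := by
  algebraize [φ]
  have hs : ∀ a x, Φ.toAddMonoidHom (a • x) = a • Φ.toAddMonoidHom x := fun a x =>
    (hΦ a x).trans (Algebra.smul_def a (Φ x)).symm
  let Φ' : (B →₀ MvPolynomial (Fin r) k) →ₗ[MvPolynomial (Fin r) k] R :=
    { Φ.toAddMonoidHom with map_smul' := hs }
  exact Module.Finite.of_surjective Φ' Φ.surjective

end Bridge

end GradedCone

end

theorem mainTheorem1 {N : Type*} [AddCommGroup N] [Module.Free ℤ N] [Module.Finite ℤ N]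
    (r : ℕ) (hr : Module.finrank ℤ N = r)
    (K : PointedCone ℝ (ℝ ⊗[ℤ] N)) (deg : Module.Dual ℤ N)
    (hK : GradedCone.IsGradedCone K deg) :
    (∀ (d : ℕ) (e : Fin d → GradedCone.latticePoints K),
      Function.Injective e →
      (∀ i, deg (e i : N) = 1) →
      (∀ n : N, GradedCone.IsRayGenerator K n → ∃ i, (e i : N) = n) →
      ∀ m : Module.Basis (Fin r) ℂ (ℂ ⊗[ℤ] Module.Dual ℤ N),
        GradedCone.ForGeneric fun a : Fin d → ℂ =>
          RingTheory.Sequence.IsRegular (GradedCone.semigroupRing K)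
            (List.ofFn fun j => GradedCone.linearElement K e a (m j)) ∧
          RingTheory.Sequence.IsRegular (GradedCone.openIdeal K)
            (List.ofFn fun j => GradedCone.linearElement K e a (m j))) ∧
    GradedCone.IsCohenMacaulayRing (GradedCone.semigroupRing K) ∧
    GradedCone.IsCohenMacaulayModule (GradedCone.semigroupRing K) (GradedCone.openIdeal K) := by
  obtain ⟨t, ht, htK⟩ := GradedCone.exists_rayGenerators hK.rationalPolyhedral hK.pointed
  refine ⟨fun d e _ hdeg hray m => ?_, ?_⟩
  · have hKe : K = PointedCone.hull ℝ (Set.range fun l => GradedCone.toReal (e l : N)) := by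
      refine le_antisymm (htK.le.trans (Submodule.span_mono ?_)) (Submodule.span_le.2 ?_)
      · rintro _ ⟨n, hn, rfl⟩
        obtain ⟨l, hl⟩ := hray n (ht n hn)
        exact ⟨l, congrArg GradedCone.toReal hl⟩
      · rintro _ ⟨l, rfl⟩
        exact (e l).2
    obtain ⟨P, hP, hfree⟩ := GradedCone.exists_polynomial_free hr hK.full e hdeg hKe m
    refine ⟨P, hP, fun a ha => ?_⟩
    obtain ⟨φ, hφ, ⟨B, -, hB, Φ, hΦ⟩, ⟨B', -, hB', Φ', hΦ'⟩⟩ := hfree a ha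
    have := hB.to_subtype
    have := hB'.to_subtype
    simp only [← hφ]
    exact ⟨GradedCone.isRegular_of_free φ.toRingHom Φ hΦ,
      GradedCone.isRegular_of_free φ.toRingHom Φ' hΦ'⟩
  · -- The generators of the rays, with any basis of `M ⊗ ℂ`, give a polynomial ring over which
    -- both modules are free of finite rank.
    have htmem : ∀ n ∈ t, n ∈ GradedCone.latticePoints K := fun n hn =>
      (ht n hn).isFaceOf.le (Submodule.subset_span rfl)
    let e : Fin t.card → GradedCone.latticePoints K := fun i =>
      ⟨t.equivFin.symm i, htmem _ (t.equivFin.symm i).2⟩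
    have hKe : K = PointedCone.hull ℝ (Set.range fun l => GradedCone.toReal (e l : N)) := by
      refine htK.trans (congrArg (PointedCone.hull ℝ) (Set.ext fun v => ⟨?_, ?_⟩))
      · rintro ⟨n, hn, rfl⟩
        exact ⟨t.equivFin ⟨n, hn⟩, by simp [e]⟩
      · rintro ⟨l, rfl⟩
        exact ⟨_, (t.equivFin.symm l).2, rfl⟩
    obtain ⟨P, hP, hfree⟩ := GradedCone.exists_polynomial_free hr hK.full e
      (fun l => hK.deg_rayGenerator _ (ht _ (t.equivFin.symm l).2)) hKe
      ((Module.finBasisOfFinrankEq ℤ N hr).dualBasis.baseChange ℂ)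
    obtain ⟨a, ha⟩ := GradedCone.exists_exp_eval_ne_zero hP
    obtain ⟨φ, -, ⟨B, hBfin, hB, Φ, hΦ⟩, ⟨B', -, hB', Φ', hΦ'⟩⟩ := hfree a ha
    have := hBfin.to_subtype
    have := hB.to_subtype
    have := hB'.to_subtype
    have hφfin : φ.toRingHom.Finite := GradedCone.finite_of_free φ.toRingHom Φ hΦ
    have hR : GradedCone.IsCohenMacaulayRing (GradedCone.semigroupRing K) :=
      GradedCone.isCohenMacaulayModule_of_free φ hφfin Φ hΦ
    have := hR.noetherian
    exact ⟨hR, GradedCone.isCohenMacaulayModule_of_free φ hφfin Φ' hΦ'⟩
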